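/- A lattice polytope in $\mathbb{R}^2$ is the convex hull of a nonempty finite subset of $\mathbb{Z}^2$; it is called free if the lattice points it contains are precisely its vertices. For a set $P \subset \mathbb{R}^2$ and integers $i \ge 1$, $n \ge 0$, let $\alpha_i(P;n)$ be the number of free lattice polytopes with exactly $i$ vertices that are contained in the dilate $nP = \{np : p \in P\}$. Let $J_1(\ell) = |\{a \in \mathbb{Z} : 1 \le a \le \ell,\ \gcd(a,\ell) = 1\}|$ (Euler's totient function, with $J_1(0)=0$). Let $P \subset \mathbb{R}^2$ be a unimodular triangle, that is, $P$ is the convex hull of points $v_0, v_1, v_2 \in \mathbb{Z}^2$ such that $v_1 - v_0,\ v_2 - v_0$ is a basis of $\mathbb{Z}^2$. For every integer $n \ge 0$ put $$\Sigma_n = \sum_{\ell=0}^{n} \binom{n-\ell+2}{2} J_1(\ell).$$ Then all the numbers $\alpha_i(P;n)$ are finite, and $$\alpha_1(P;n) = \binom{n+2}{2}, \qquad \alpha_2(P;n) = 3\,\Sigma_n,$$ $$\alpha_3(P;n) = 6\,\Sigma_n - 2n^2 - 3n, \qquad \alpha_4(P;n) = 3\,\Sigma_n - \tfrac{3}{2}(n^2+n),$$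 and $\alpha_i(P;n) = 0$ for all $i > 4$. -/

import Mathlib

open scoped Pointwise

namespace FreePolytopes

/-- The embedding of the integer lattice `ℤ^d` into `ℝ^d`. -/
def toReal {d : ℕ} (v : Fin d → ℤ) : Fin d → ℝ := fun i => (v i : ℝ)

/-- The lattice `ℤ^d` as a subset of `ℝ^d`. -/
def lattice (d : ℕ) : Set (Fin d → ℝ) := Set.range (toReal (d := d))

/-- A (nonempty) lattice polytope: the convex hull of finitely many points of `ℤ^d`. -/
def IsLatticePolytope {d : ℕ} (Q : Set (Fin d → ℝ)) : Prop :=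
  ∃ s : Finset (Fin d → ℤ), s.Nonempty ∧ Q = convexHull ℝ (toReal '' (s : Set (Fin d → ℤ)))

/-- A lattice polytope is free if its lattice points are precisely its vertices. -/
def IsFree {d : ℕ} (Q : Set (Fin d → ℝ)) : Prop :=
  IsLatticePolytope Q ∧ Q ∩ lattice d = Q.extremePoints ℝ

/-- The set of free polytopes contained in `S` that have exactly `i` lattice points. -/
def freePolytopes {d : ℕ} (i : ℕ) (S : Set (Fin d → ℝ)) : Set (Set (Fin d → ℝ)) :=
  {Q | IsFree Q ∧ Q ⊆ S ∧ (Q ∩ lattice d).encard = i}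

/-- `α_i(P; n)`: the number of free polytopes with `i` vertices in the dilate `n P`. -/
noncomputable def alpha {d : ℕ} (i : ℕ) (P : Set (Fin d → ℝ)) (n : ℕ) : ℕ :=
  (freePolytopes i ((n : ℝ) • P)).ncard

/-- A unimodular `d`-simplex in `ℝ^d`: the convex hull of `d + 1` lattice points `v 0, …, v d`
such that the edge vectors `v 1 - v 0, …, v d - v 0` form a basis of `ℤ^d`. -/
def IsUnimodularSimplex {d : ℕ} (P : Set (Fin d → ℝ)) : Prop :=
  ∃ v : Fin (d + 1) → (Fin d → ℤ),
    IsUnit (Matrix.det (Matrix.of fun i j : Fin d => v i.succ j - v 0 j)) ∧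
    P = convexHull ℝ (Set.range fun i => toReal (v i))

/-- The Jordan totient function `J_k(n)`: the number of `(a_1, …, a_k) ∈ ℤ^k` with
`1 ≤ a_i ≤ n` and `gcd(a_1, …, a_k, n) = 1`. -/
noncomputable def jordanTotient (k n : ℕ) : ℕ :=
  ((Fintype.piFinset fun _ : Fin k => Finset.Icc (1 : ℤ) (n : ℤ)).filter
    fun a => Int.gcd (Finset.univ.gcd a) (n : ℤ) = 1).card

end FreePolytopes

namespace FreePolytopes

/-! A free polytope is the hull of a unique finite set of lattice points, its vertex set
(`FreeSet`), so one counts finite sets. Midpoints modulo 2 allow at most four vertices in the plane.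
Since a free polytope contains no further lattice point, two vertices differ by a primitive vector,
three span a unimodular triangle and four form a unimodular parallelogram; conversely all these sets
are free. An integral affine change of coordinates turns `nP` into the triangle `x, y ≥ 0`, `x + y ≤
n`.

The order 3 symmetry `rot` of this triangle, together with sign, moves each nonzero vector into the
half-open quadrant `d.1 ≥ 1`, `d.2 ≥ 0` in exactly one way. So there are three times as many
segments as elements of `directed n`. Sorting these by `l = d.1 + d.2` gives Σ_n: there are J_1(l)
primitive vectors and C(n-l+2, 2) base points for each.

For larger shapes, take a longest segment in the hexagonal norm `hex`. If its length exceeds 1, its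
direction is uniquely a sum `u + v` of Farey parents, and every other vertex is `p + u` or `p + v`
(`Unimodular.subset_quad`). So such a segment is the long diagonal of one parallelogram and the
longest side of two triangles. If all lengths are at most 1, only the small up and down triangles
occur. With `B = (bases n).ncard` there are `3B` parallelograms and `6B + C(n+1, 2) + C(n, 2)`
triangles, while `Σ_n = B + C(n+1, 2)`, the last term counting the direction `(1, 0)`. Eliminating
`B` gives the formulas. -/

/-! ### Free polytopes and their vertex sets -/

lemma toReal_injective {d : ℕ} : Function.Injective (toReal (d := d)) := by
  intro a b h
  funext i
  have := congrFun h i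
  simpa [toReal] using this

/-- The lattice polytope spanned by a finite set of lattice points. -/
def hull {d : ℕ} (s : Finset (Fin d → ℤ)) : Set (Fin d → ℝ) :=
  convexHull ℝ (toReal '' (s : Set (Fin d → ℤ)))

/-- A finite set of lattice points that is the vertex set of a free polytope. -/
def FreeSet {d : ℕ} (s : Finset (Fin d → ℤ)) : Prop :=
  s.Nonempty ∧ (∀ z, toReal z ∈ hull s → z ∈ s) ∧ ∀ z ∈ s, toReal z ∈ (hull s).extremePoints ℝ

lemma toReal_mem_hull {d : ℕ} {s : Finset (Fin d → ℤ)} {z : Fin d → ℤ} (hz : z ∈ s) :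
    toReal z ∈ hull s :=
  subset_convexHull ℝ _ ⟨z, hz, rfl⟩

lemma hull_mono {d : ℕ} {s t : Finset (Fin d → ℤ)} (h : s ⊆ t) : hull s ⊆ hull t :=
  convexHull_mono (Set.image_mono (by exact_mod_cast h))

lemma FreeSet.hull_inter_lattice {d : ℕ} {s : Finset (Fin d → ℤ)} (hs : FreeSet s) :
    hull s ∩ lattice d = toReal '' (s : Set (Fin d → ℤ)) := by
  ext x
  constructor
  · rintro ⟨hx, z, rfl⟩
    exact ⟨z, hs.2.1 z hx, rfl⟩
  · rintro ⟨z, hz, rfl⟩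
    exact ⟨toReal_mem_hull hz, z, rfl⟩

/-- Extreme points of a hull lie among its generators, so freeness forces the generating set to be
the set of all lattice points of the polytope. -/
lemma isFree_iff {d : ℕ} {Q : Set (Fin d → ℝ)} : IsFree Q ↔ ∃ s, FreeSet s ∧ Q = hull s := by
  constructor
  · rintro ⟨⟨s, hne, rfl⟩, h⟩
    refine ⟨s, ⟨hne, ?_, ?_⟩, rfl⟩
    · intro z hz
      have h1 : toReal z ∈ (hull s).extremePoints ℝ := h ▸ ⟨hz, z, rfl⟩
      obtain ⟨y, hy, hyz⟩ := extremePoints_convexHull_subset h1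
      exact toReal_injective hyz ▸ hy
    · intro z hz
      exact h ▸ ⟨toReal_mem_hull hz, z, rfl⟩
  · rintro ⟨s, hs, rfl⟩
    refine ⟨⟨s, hs.1, rfl⟩, ?_⟩
    rw [hs.hull_inter_lattice]
    apply Set.Subset.antisymm
    · rintro _ ⟨z, hz, rfl⟩
      exact hs.2.2 z hz
    · exact extremePoints_convexHull_subset

lemma hull_injOn {d : ℕ} : Set.InjOn (hull (d := d)) {s | FreeSet s} := by
  intro s hs t ht h
  have h1 := hs.hull_inter_lattice
  rw [h, FreeSet.hull_inter_lattice ht] at h1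
  exact_mod_cast (toReal_injective.image_injective h1).symm

lemma freePolytopes_eq_image {d : ℕ} (i : ℕ) {X : Set (Fin d → ℝ)} (hX : Convex ℝ X) :
    freePolytopes i X =
      hull '' {s : Finset (Fin d → ℤ) | FreeSet s ∧ (∀ z ∈ s, toReal z ∈ X) ∧ s.card = i} := by
  have hcard : ∀ s : Finset (Fin d → ℤ), FreeSet s → (hull s ∩ lattice d).encard = s.card := by
    intro s hs
    rw [hs.hull_inter_lattice, toReal_injective.encard_image, Set.encard_coe_eq_coe_finsetCard]
  ext Q
  constructor
  · rintro ⟨hf, hQ, hc⟩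
    obtain ⟨s, hs, rfl⟩ := isFree_iff.1 hf
    refine ⟨s, ⟨hs, fun z hz => hQ (toReal_mem_hull hz), ?_⟩, rfl⟩
    rw [hcard s hs] at hc
    exact_mod_cast hc
  · rintro ⟨s, ⟨hs, hsX, hc⟩, rfl⟩
    refine ⟨isFree_iff.2 ⟨s, hs, rfl⟩, convexHull_min ?_ hX, ?_⟩
    · rintro _ ⟨z, hz, rfl⟩
      exact hsX z hz
    · rw [hcard s hs, hc]

/-- A point extreme in a convex set stays extreme in any smaller one containing it. Hence conditions
on pairs and triples apply inside larger free sets, and freeness of the unit parallelogram yields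
that of points, segments and triangles. -/
lemma FreeSet.subset {d : ℕ} {s t : Finset (Fin d → ℤ)} (hs : FreeSet s) (hts : t ⊆ s)
    (ht : t.Nonempty) : FreeSet t := by
  have key : ∀ z, toReal z ∈ hull t → toReal z ∈ (hull t).extremePoints ℝ := by
    intro z hz
    have h1 := hs.2.2 z (hs.2.1 z (hull_mono hts hz))
    exact ⟨hz, fun x hx y hy h => h1.2 (hull_mono hts hx) (hull_mono hts hy) h⟩
  refine ⟨ht, fun z hz => ?_, fun z hz => key z (toReal_mem_hull hz)⟩
  obtain ⟨y, hy, hyz⟩ := extremePoints_convexHull_subset (key z hz)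
  exact toReal_injective hyz ▸ hy

/-! ### Planar free sets: primitive segments, unimodular triangles, parallelograms -/

/-- The determinant of two integer vectors. -/
def det (u v : Fin 2 → ℤ) : ℤ := u 0 * v 1 - u 1 * v 0

/-- The affine coordinates `f`, `g` along `u`, `v` take integer values at lattice points because the
determinant is 1, and the hull lies in the unit square of these coordinates. So its lattice points
have coordinates 0 or 1, and such points are extreme. -/
lemma freeSet_parallelogram {u v : Fin 2 → ℤ} (p : Fin 2 → ℤ) (h : det u v = 1) :
    FreeSet {p, p + u, p + v, p + u + v} := by
  set S : Finset (Fin 2 → ℤ) := {p, p + u, p + v, p + u + v} with hS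
  have hR : (u 0 : ℝ) * v 1 - u 1 * v 0 = 1 := by exact_mod_cast h
  let f : (Fin 2 → ℝ) → ℝ := fun q => (q 0 - p 0) * v 1 - (q 1 - p 1) * v 0
  let g : (Fin 2 → ℝ) → ℝ := fun q => u 0 * (q 1 - p 1) - u 1 * (q 0 - p 0)
  have hcomb : ∀ (x y : Fin 2 → ℝ) (a b : ℝ), a + b = 1 →
      f (a • x + b • y) = a * f x + b * f y ∧ g (a • x + b • y) = a * g x + b * g y := by
    intro x y a b hab
    obtain rfl : b = 1 - a := by linarith
    simp only [f, g, Pi.add_apply, Pi.smul_apply, smul_eq_mul]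
    constructor <;> ring
  have hfg : ∀ q : Fin 2 → ℝ, ∀ i, q i = p i + f q * u i + g q * v i := by
    intro q i
    fin_cases i <;> simp only [f, g, Fin.zero_eta, Fin.mk_one] <;>
      linear_combination (-(q _) + p _) * hR
  have hbox : hull S ⊆ {q | (0 ≤ f q ∧ f q ≤ 1) ∧ 0 ≤ g q ∧ g q ≤ 1} := by
    apply convexHull_min
    · rintro _ ⟨z, hz, rfl⟩
      simp only [hS, Finset.coe_insert, Finset.coe_singleton, Set.mem_insert_iff,
        Set.mem_singleton_iff] at hz
      rcases hz with rfl | rfl | rfl | rfl <;>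
        simp only [f, g, toReal, Set.mem_ofPred_eq, Pi.add_apply, Int.cast_add] <;>
        refine ⟨⟨?_, ?_⟩, ?_, ?_⟩ <;> nlinarith
    · rintro x ⟨⟨h1, h2⟩, h3, h4⟩ y ⟨⟨h5, h6⟩, h7, h8⟩ a b ha hb hab
      obtain ⟨e1, e2⟩ := hcomb x y a b hab
      simp only [Set.mem_ofPred_eq, e1, e2]
      refine ⟨⟨?_, ?_⟩, ?_, ?_⟩ <;> nlinarith
  have hint : ∀ z : Fin 2 → ℤ, toReal z ∈ hull S →
      ((f (toReal z) = 0 ∨ f (toReal z) = 1) ∧ (g (toReal z) = 0 ∨ g (toReal z) = 1)) := by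
    intro z hz
    obtain ⟨⟨h1, h2⟩, h3, h4⟩ := hbox hz
    have ef : f (toReal z) = (((z 0 - p 0) * v 1 - (z 1 - p 1) * v 0 : ℤ) : ℝ) := by
      simp [f, toReal]
    have eg : g (toReal z) = ((u 0 * (z 1 - p 1) - u 1 * (z 0 - p 0) : ℤ) : ℝ) := by
      simp [g, toReal]
    rw [ef] at h1 h2 ⊢
    rw [eg] at h3 h4 ⊢
    norm_cast at h1 h2 h3 h4 ⊢
    omega
  refine ⟨⟨p, by simp [hS]⟩, ?_, ?_⟩
  · intro z hz
    have hz' : ∀ i, (z i : ℝ) = p i + f (toReal z) * u i + g (toReal z) * v i :=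
      hfg (toReal z)
    have : z = p ∨ z = p + u ∨ z = p + v ∨ z = p + u + v := by
      obtain ⟨h1 | h1, h2 | h2⟩ := hint z hz <;> rw [h1, h2] at hz'
      · left; funext i; have := hz' i; simp at this; exact this
      · right; right; left; funext i; have := hz' i; simp at this; exact_mod_cast this
      · right; left; funext i; have := hz' i; simp at this; exact_mod_cast this
      · right; right; right; funext i; have := hz' i; simp at this; exact_mod_cast this
    simpa [hS] using this
  · intro z hz
    refine ⟨toReal_mem_hull hz, ?_⟩
    rintro x hx y hy ⟨a, b, ha, hb, hab, hxy⟩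
    obtain ⟨e1, e2⟩ := hcomb x y a b hab
    rw [hxy] at e1 e2
    obtain ⟨⟨h1, h2⟩, h3, h4⟩ := hbox hx
    obtain ⟨⟨h5, h6⟩, h7, h8⟩ := hbox hy
    obtain ⟨hf, hg⟩ := hint z (toReal_mem_hull hz)
    have extremal : ∀ {s t r : ℝ}, 0 ≤ s → s ≤ 1 → 0 ≤ t → t ≤ 1 → r = a * s + b * t →
        r = 0 ∨ r = 1 → s = r := by
      rintro s t r hs0 hs1 ht0 ht1 hr (rfl | rfl)
      · nlinarith [mul_nonneg ha.le hs0, mul_nonneg hb.le ht0]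
      · have : a * (1 - s) = 0 := by
          nlinarith [mul_nonneg ha.le (sub_nonneg.2 hs1), mul_nonneg hb.le (sub_nonneg.2 ht1)]
        rcases mul_eq_zero.1 this with h | h <;> linarith
    have ef := extremal h1 h2 h5 h6 e1 hf
    have eg := extremal h3 h4 h7 h8 e2 hg
    funext i
    rw [hfg x i, hfg (toReal z) i, ef, eg]

lemma mem_hull_pair {d : ℕ} {a b z : Fin d → ℤ} (t : ℝ) (h0 : 0 ≤ t) (h1 : t ≤ 1)
    (hz : ∀ i, (z i : ℝ) = (1 - t) * a i + t * b i) : toReal z ∈ hull {a, b} := by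
  have : toReal z = (1 - t) • toReal a + t • toReal b := by
    funext i; simpa [toReal] using hz i
  rw [this]
  exact convex_convexHull ℝ _ (toReal_mem_hull (by simp)) (toReal_mem_hull (by simp))
    (by linarith) h0 (by ring)

lemma mem_hull_triple {d : ℕ} {a b c z : Fin d → ℤ} (r s t : ℝ) (h0 : 0 ≤ r) (h1 : 0 ≤ s)
    (h2 : 0 ≤ t) (h : r + s + t = 1)
    (hz : ∀ i, (z i : ℝ) = r * a i + s * b i + t * c i) : toReal z ∈ hull {a, b, c} := by
  have hz' : toReal z = r • toReal a + s • toReal b + t • toReal c := by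
    funext i; simpa [toReal] using hz i
  rw [hz', hull]
  have := (convex_convexHull ℝ (toReal '' (({a, b, c} : Finset (Fin d → ℤ)) : Set _))).sum_mem
    (t := Finset.univ) (w := ![r, s, t]) (z := ![toReal a, toReal b, toReal c])
    (by intro i _; fin_cases i <;> simpa) (by simpa [Fin.sum_univ_three] using h)
    (by intro i _; fin_cases i <;> exact toReal_mem_hull (by simp))
  simpa [Fin.sum_univ_three] using this

/-- Dividing `b - a` by the gcd of its entries gives a lattice point on the segment; it must be an
endpoint. -/
lemma FreeSet.isCoprime {a b : Fin 2 → ℤ} (h : FreeSet {a, b}) (hab : a ≠ b) :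
    IsCoprime ((b - a) 0) ((b - a) 1) := by
  rw [Int.isCoprime_iff_gcd_eq_one]
  set g := Int.gcd ((b - a) 0) ((b - a) 1) with hg
  have hg0 : g ≠ 0 := by
    intro h0
    rw [hg, Int.gcd_eq_zero_iff] at h0
    apply hab
    funext i
    fin_cases i
    · have := h0.1; simp at this ⊢; omega
    · have := h0.2; simp at this ⊢; omega
  obtain ⟨x, hx⟩ : (g : ℤ) ∣ (b - a) 0 := Int.gcd_dvd_left ..
  obtain ⟨y, hy⟩ : (g : ℤ) ∣ (b - a) 1 := Int.gcd_dvd_right ..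
  have hgR : (g : ℝ) ≠ 0 := by exact_mod_cast hg0
  have hg1 : (1 : ℝ) ≤ g := by exact_mod_cast Nat.one_le_iff_ne_zero.2 hg0
  have hb : ∀ i, (b i : ℝ) = a i + g * ((![x, y] : Fin 2 → ℤ) i : ℝ) := by
    intro i
    fin_cases i
    · have : b 0 = a 0 + g * x := by simp at hx; linarith
      simp [this]
    · have : b 1 = a 1 + g * y := by simp at hy; linarith
      simp [this]
  have hz : toReal (a + ![x, y]) ∈ hull {a, b} := by
    refine mem_hull_pair (1 / g) (by positivity) (by rw [div_le_one (by linarith)]; exact hg1) ?_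
    intro i
    rw [hb i]
    simp only [Pi.add_apply, Int.cast_add]
    field_simp
    ring
  have := h.2.1 _ hz
  simp only [Finset.mem_insert, Finset.mem_singleton] at this
  rcases this with h1 | h1
  · exfalso
    apply hab
    have hxy : (![x, y] : Fin 2 → ℤ) = 0 := add_eq_left.1 h1
    funext i
    have := hb i
    rw [hxy] at this
    simp at this
    exact this.symm
  · have h0 := congrFun h1 0
    have h1 := congrFun h1 1
    simp at h0 h1 hx hy
    by_contra hne
    have hx0 : ((g : ℤ) - 1) * x = 0 := by linarith
    have hy0 : ((g : ℤ) - 1) * y = 0 := by linarith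
    have hne' : ((g : ℤ) - 1) ≠ 0 := by omega
    have hx1 := (mul_eq_zero.1 hx0).resolve_left hne'
    have hy1 := (mul_eq_zero.1 hy0).resolve_left hne'
    apply hab
    subst hx1 hy1
    funext i
    fin_cases i <;> simp <;> linarith

/-- If `D > 0`, Bézout gives a vector of determinant 1 with `u`. The line of lattice points it
determines, parallel to `u`, meets the triangle in a lattice point, which must be a vertex; only `c`
is off the line `ab`, so `c` itself has determinant 1. If `D = 0`, primitivity gives `v = ±u`: then
`c = b`, or `c - b` is divisible by 2. -/
lemma FreeSet.det_eq_one_of_nonneg {a b c : Fin 2 → ℤ} (h : FreeSet {a, b, c}) (hab : a ≠ b)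
    (hac : a ≠ c) (hbc : b ≠ c) (hD : 0 ≤ det (b - a) (c - a)) : det (b - a) (c - a) = 1 := by
  obtain ⟨x, y, hxy⟩ := FreeSet.isCoprime
    (h.subset (t := {a, b}) (by intro z; simp; tauto) (by simp)) hab
  set u := b - a with hu
  set v := c - a with hv
  set X := v 0 * x + v 1 * y with hX
  rcases hD.eq_or_lt with hD | hD
  · exfalso
    have hD' : u 0 * v 1 - u 1 * v 0 = 0 := hD.symm
    have hvX : ∀ i, v i = X * u i := by
      intro i
      fin_cases i <;> simp only [Fin.zero_eta, Fin.mk_one, hX]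
      · linear_combination -(v 0) * hxy - y * hD'
      · linear_combination -(v 1) * hxy + x * hD'
    have hc1 : IsCoprime (v 0) (v 1) := FreeSet.isCoprime
      (h.subset (t := {a, c}) (by intro z; simp; tauto) (by simp)) hac
    have hXu : IsUnit X :=
      hc1.isUnit_of_dvd' ⟨u 0, hvX 0⟩ ⟨u 1, hvX 1⟩
    rcases Int.isUnit_iff.1 hXu with h1 | h1
    · apply hbc
      funext i
      have := hvX i
      rw [h1] at this
      simp only [hu, hv, Pi.sub_apply] at this
      linarith
    · have hc2 : IsCoprime ((c - b) 0) ((c - b) 1) := FreeSet.isCoprime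
        (h.subset (t := {b, c}) (by intro z; simp; tauto) (by simp)) hbc
      have h2 : ∀ i, (c - b) i = 2 * (-(u i)) := by
        intro i
        have := hvX i
        rw [h1] at this
        simp only [hu, hv, Pi.sub_apply] at this ⊢
        linarith
      have := hc2.isUnit_of_dvd' ⟨_, h2 0⟩ ⟨_, h2 1⟩
      rcases Int.isUnit_iff.1 this with h | h <;> omega
  · set D := det u v with hDdef
    have hDdef' : D = u 0 * v 1 - u 1 * v 0 := rfl
    have hvX : ∀ i, v i = X * u i + D * (![-y, x] : Fin 2 → ℤ) i := by
      intro i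
      fin_cases i <;> simp [hX, hDdef']
      · linear_combination -(v 0) * hxy
      · linear_combination -(v 1) * hxy
    -- `k` is the ceiling of `X / D`. The numbers `k * D - X` step by `D`, so one of them lies among
    -- the `D` integers `0, …, D - 1`; this makes the barycentric coordinates below nonnegative.
    obtain ⟨k, hk1, hk2⟩ : ∃ k : ℤ, 0 ≤ k * D - X ∧ k * D - X ≤ D - 1 := by
      refine ⟨-((-X) / D), ?_, ?_⟩ <;>
        nlinarith [Int.emod_nonneg (-X) hD.ne', Int.emod_lt_of_pos (-X) hD,
          Int.mul_ediv_add_emod (-X) D]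
    have hDR : (0 : ℝ) < D := by exact_mod_cast hD
    have hz : toReal (a + k • u + ![-y, x]) ∈ hull {a, b, c} := by
      have hk1' : (0 : ℝ) ≤ k * D - X := by exact_mod_cast hk1
      have hk2' : (k : ℝ) * D - X ≤ D - 1 := by exact_mod_cast hk2
      refine mem_hull_triple ((D - 1 - (k * D - X)) / D) ((k * D - X) / D) (1 / D)
        (div_nonneg (by linarith) hDR.le) (div_nonneg hk1' hDR.le) (by positivity)
        (by field_simp; ring) ?_
      intro i
      have h1 : (c i : ℝ) = a i + (X * u i + D * ((![-y, x] : Fin 2 → ℤ) i : ℝ)) := by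
        have := hvX i
        simp only [hv, Pi.sub_apply] at this
        have : c i = a i + (X * u i + D * (![-y, x] : Fin 2 → ℤ) i) := by linarith
        rw [this]; push_cast; ring
      have h2 : (b i : ℝ) = a i + u i := by simp [hu]
      rw [h1, h2]
      simp only [Pi.add_apply, Pi.smul_apply, smul_eq_mul, Int.cast_add, Int.cast_mul]
      field_simp
      ring
    have := h.2.1 _ hz
    have hdet : det u ((a + k • u + ![-y, x]) - a) = 1 := by
      rw [show (a + k • u + ![-y, x]) - a = k • u + ![-y, x] by abel]
      simp only [det, Pi.add_apply, Pi.smul_apply, smul_eq_mul, Matrix.cons_val_zero,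
        Matrix.cons_val_one]
      linear_combination hxy
    simp only [Finset.mem_insert, Finset.mem_singleton] at this
    rcases this with h1 | h1 | h1 <;> rw [h1] at hdet
    · simp [det] at hdet
    · simp [det, hu] at hdet
      exfalso; linarith
    · exact hdet

/-- Any three vertices of a free polygon span a triangle of area one half. -/
lemma FreeSet.isUnit_det {a b c : Fin 2 → ℤ} (h : FreeSet {a, b, c}) (hab : a ≠ b)
    (hac : a ≠ c) (hbc : b ≠ c) : IsUnit (det (b - a) (c - a)) := by
  rw [Int.isUnit_iff]
  rcases le_total 0 (det (b - a) (c - a)) with h0 | h0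
  · exact .inl (h.det_eq_one_of_nonneg hab hac hbc h0)
  · right
    have h1 : det (a - b) (c - b) = - det (b - a) (c - a) := by simp [det]; ring
    have := FreeSet.det_eq_one_of_nonneg (a := b) (b := a) (c := c)
      (by rwa [Finset.insert_comm]) hab.symm hbc hac (by rw [h1]; omega)
    omega

lemma FreeSet.parallelogram {a b c d : Fin 2 → ℤ} (h : FreeSet {a, b, c, d}) (hab : a ≠ b)
    (hac : a ≠ c) (had : a ≠ d) (hbc : b ≠ c) (hbd : b ≠ d) (hcd : c ≠ d) :
    ∃ p u v, IsUnit (det u v) ∧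
      ({a, b, c, d} : Finset (Fin 2 → ℤ)) = {p, p + u, p + v, p + u + v} := by
  have h1 := FreeSet.isUnit_det
    (h.subset (t := {a, b, c}) (by intro z; simp; tauto) (by simp)) hab hac hbc
  have h2 := FreeSet.isUnit_det
    (h.subset (t := {a, b, d}) (by intro z; simp; tauto) (by simp)) hab had hbd
  have h3 := FreeSet.isUnit_det
    (h.subset (t := {a, c, d}) (by intro z; simp; tauto) (by simp)) hac had hcd
  have h4 := FreeSet.isUnit_det
    (h.subset (t := {b, c, d}) (by intro z; simp; tauto) (by simp)) hbc hbd hcd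
  -- Signed areas of the four triangles. Via `key`, their signs give `d - a = ±(b - a) ± (c - a)`;
  -- two minus signs would make the area in `h5` equal to ±3.
  have h5 : det (c - b) (d - b) =
      det (b - a) (c - a) + det (c - a) (d - a) - det (b - a) (d - a) := by simp [det]; ring
  have key : ∀ i, det (b - a) (c - a) * (d - a) i =
      -(det (c - a) (d - a)) * (b - a) i + det (b - a) (d - a) * (c - a) i := by
    intro i
    fin_cases i <;> simp [det] <;> ring
  have hsum : a + d = b + c ∨ a + b = c + d ∨ a + c = b + d := by
    rw [h5] at h4
    rw [Int.isUnit_iff] at h1 h2 h3 h4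
    have : (∀ i, (d - a) i = (b - a) i + (c - a) i) ∨ (∀ i, (d - a) i = (b - a) i - (c - a) i) ∨
        (∀ i, (d - a) i = (c - a) i - (b - a) i) := by
      rcases h1 with h1 | h1 <;> rcases h2 with h2 | h2 <;> rcases h3 with h3 | h3 <;>
        rw [h1, h2, h3] at h4 key <;> first
        | omega
        | (left; intro i; linarith [key i])
        | (right; left; intro i; linarith [key i])
        | (right; right; intro i; linarith [key i])
    rcases this with h | h | h
    · left; funext i; have := h i; simp at this ⊢; linarith
    · right; left; funext i; have := h i; simp at this ⊢; linarith
    · right; right; funext i; have := h i; simp at this ⊢; linarith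
  rcases hsum with e | e | e
  · refine ⟨a, b - a, c - a, h1, ?_⟩
    have : d = b + c - a := by rw [← e]; abel
    subst this
    congr 1
    rw [show a + (b - a) = b by abel, show a + (c - a) = c by abel,
      show b + (c - a) = b + c - a by abel]
  · refine ⟨a, c - a, d - a, h3, ?_⟩
    have : b = c + d - a := by rw [← e]; abel
    subst this
    rw [show a + (c - a) = c by abel, show a + (d - a) = d by abel,
      show c + (d - a) = c + d - a by abel]
    ext; simp; tauto
  · refine ⟨a, b - a, d - a, h2, ?_⟩
    have : c = b + d - a := by rw [← e]; abel
    subst this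
    rw [show a + (b - a) = b by abel, show a + (d - a) = d by abel,
      show b + (d - a) = b + d - a by abel]
    ext; simp; tauto

/-- Among more than `2 ^ d` points two agree modulo 2. Their midpoint is a lattice point of the
hull, hence a vertex, yet lies inside a segment. -/
lemma FreeSet.card_le {d : ℕ} {s : Finset (Fin d → ℤ)} (h : FreeSet s) : s.card ≤ 2 ^ d := by
  by_contra! hc
  have hc' : (Finset.univ : Finset (Fin d → ZMod 2)).card < s.card := by simpa using hc
  obtain ⟨x, hx, y, hy, hxy, e⟩ := Finset.exists_ne_map_eq_of_card_lt_of_maps_to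
    (f := fun z i => ((z i : ℤ) : ZMod 2)) hc' (fun _ _ => Finset.mem_univ _)
  have h2 : ∀ i, ∃ k, x i - y i = 2 * k := by
    intro i
    have := congrFun e i
    rw [ZMod.intCast_eq_intCast_iff_dvd_sub] at this
    obtain ⟨k, hk⟩ := this
    exact ⟨-k, by push_cast at hk; linarith⟩
  choose k hk using h2
  have hz : toReal (y + k) = (1 / 2 : ℝ) • toReal x + (1 / 2 : ℝ) • toReal y := by
    funext i
    have : (x i : ℝ) - y i = 2 * k i := by exact_mod_cast hk i
    simp only [toReal, Pi.add_apply, Int.cast_add, Pi.smul_apply, smul_eq_mul]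
    linarith
  have hmem : toReal (y + k) ∈ hull s := by
    rw [hz]
    exact convex_convexHull ℝ _ (toReal_mem_hull hx) (toReal_mem_hull hy) (by norm_num)
      (by norm_num) (by norm_num)
  have hext := h.2.2 _ (h.2.1 _ hmem)
  have hm : toReal (y + k) ∈ openSegment ℝ (toReal x) (toReal y) :=
    ⟨1 / 2, 1 / 2, by norm_num, by norm_num, by norm_num, hz.symm⟩
  have e1 := hext.2 (toReal_mem_hull hx) (toReal_mem_hull hy) hm
  have e2 := hext.2 (toReal_mem_hull hy) (toReal_mem_hull hx) (by rwa [openSegment_symm])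
  exact hxy (toReal_injective (e1.trans e2.symm))

lemma freeSet_parallelogram_of_isUnit {u v : Fin 2 → ℤ} (p : Fin 2 → ℤ) (h : IsUnit (det u v)) :
    FreeSet {p, p + u, p + v, p + u + v} := by
  rcases Int.isUnit_iff.1 h with h | h
  · exact freeSet_parallelogram p h
  · have := freeSet_parallelogram (u := v) (v := u) p (by simp only [det] at h ⊢; linarith)
    convert this using 1
    rw [show p + u + v = p + v + u by abel]
    ext; simp; tauto

lemma freeSet_card_one {s : Finset (Fin 2 → ℤ)} :
    (FreeSet s ∧ s.card = 1) ↔ ∃ p, s = {p} := by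
  constructor
  · rintro ⟨-, h⟩
    exact Finset.card_eq_one.1 h
  · rintro ⟨p, rfl⟩
    exact ⟨(freeSet_parallelogram (u := ![1, 0]) (v := ![0, 1]) p (by simp [det])).subset
      (by simp) (by simp), rfl⟩

lemma freeSet_card_two {s : Finset (Fin 2 → ℤ)} :
    (FreeSet s ∧ s.card = 2) ↔ ∃ p u, IsCoprime (u 0) (u 1) ∧ s = {p, p + u} := by
  constructor
  · rintro ⟨h, hc⟩
    obtain ⟨a, b, hab, rfl⟩ := Finset.card_eq_two.1 hc
    exact ⟨a, b - a, h.isCoprime hab, by simp⟩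
  · rintro ⟨p, u, ⟨x, y, h⟩, rfl⟩
    refine ⟨(freeSet_parallelogram (u := u) (v := ![-y, x]) p
      (by simp [det]; linarith)).subset (by intro z; simp; tauto) (by simp), ?_⟩
    apply Finset.card_pair
    intro e
    have : u = 0 := by simpa using e.symm
    simp [this] at h

lemma freeSet_card_three {s : Finset (Fin 2 → ℤ)} :
    (FreeSet s ∧ s.card = 3) ↔ ∃ p u v, IsUnit (det u v) ∧ s = {p, p + u, p + v} := by
  constructor
  · rintro ⟨h, hc⟩
    obtain ⟨a, b, c, hab, hac, hbc, rfl⟩ := Finset.card_eq_three.1 hc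
    exact ⟨a, b - a, c - a, h.isUnit_det hab hac hbc, by simp⟩
  · rintro ⟨p, u, v, h, rfl⟩
    refine ⟨(freeSet_parallelogram_of_isUnit p h).subset (by intro z; simp; tauto) (by simp), ?_⟩
    rw [Finset.card_eq_three]
    refine ⟨_, _, _, ?_, ?_, ?_, rfl⟩
    · intro e
      have : u = 0 := by simpa using e.symm
      simp [this, det] at h
    · intro e
      have : v = 0 := by simpa using e.symm
      simp [this, det] at h
    · intro e
      have : u = v := by simpa using e
      simp [this, det, mul_comm] at h

lemma freeSet_card_four {s : Finset (Fin 2 → ℤ)} :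
    (FreeSet s ∧ s.card = 4) ↔
      ∃ p u v, IsUnit (det u v) ∧ s = {p, p + u, p + v, p + u + v} := by
  constructor
  · rintro ⟨h, hc⟩
    obtain ⟨a, t, hat, rfl, ht⟩ := Finset.card_eq_succ.1 hc
    obtain ⟨b, c, d, hbc, hbd, hcd, rfl⟩ := Finset.card_eq_three.1 ht
    simp only [Finset.mem_insert, Finset.mem_singleton, not_or] at hat
    exact h.parallelogram hat.1 hat.2.1 hat.2.2 hbc hbd hcd
  · rintro ⟨p, u, v, h, rfl⟩
    refine ⟨freeSet_parallelogram_of_isUnit p h, ?_⟩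
    have h3 := (freeSet_card_three.2 ⟨p, u, v, h, rfl⟩).2
    have : p + u + v ∉ ({p, p + u, p + v} : Finset (Fin 2 → ℤ)) := by
      simp only [Finset.mem_insert, Finset.mem_singleton, not_or]
      refine ⟨?_, ?_, ?_⟩
      · intro e
        have : v = -u := by rw [add_assoc] at e; exact (neg_eq_of_add_eq_zero_right (by simpa using e)).symm
        simp [this, det, mul_comm] at h
      · intro e
        have : v = 0 := by simpa using e
        simp [this, det] at h
      · intro e
        have : u = 0 := by
          rw [add_right_comm] at e
          simpa using e
        simp [this, det] at h
    rw [show ({p, p + u, p + v, p + u + v} : Finset (Fin 2 → ℤ)) =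
      insert (p + u + v) {p, p + u, p + v} by ext; simp; tauto, Finset.card_insert_of_notMem this,
      h3]

/-! ### Coordinates adapted to the unimodular triangle -/

/-- The determinant of two integer vectors, written as pairs. -/
def pdet (u v : ℤ × ℤ) : ℤ := u.1 * v.2 - u.2 * v.1

/-- The lattice points of the `n`-th dilate of the standard triangle. -/
def triPoints (n : ℕ) : Set (ℤ × ℤ) := {p | 0 ≤ p.1 ∧ 0 ≤ p.2 ∧ p.1 + p.2 ≤ n}

/-- The primitive segments in the dilated standard triangle. -/
def segments (n : ℕ) : Set (Finset (ℤ × ℤ)) :=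
  {S | (∀ p ∈ S, p ∈ triPoints n) ∧ ∃ p u : ℤ × ℤ, IsCoprime u.1 u.2 ∧ S = {p, p + u}}

/-- The unimodular triangles in the dilated standard triangle. -/
def triangles (n : ℕ) : Set (Finset (ℤ × ℤ)) :=
  {S | (∀ p ∈ S, p ∈ triPoints n) ∧ ∃ p u v : ℤ × ℤ, pdet u v = 1 ∧ S = {p, p + u, p + v}}

/-- The unimodular parallelograms in the dilated standard triangle. -/
def parallelograms (n : ℕ) : Set (Finset (ℤ × ℤ)) :=
  {S | (∀ p ∈ S, p ∈ triPoints n) ∧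
    ∃ p u v : ℤ × ℤ, pdet u v = 1 ∧ S = {p, p + u, p + v, p + u + v}}

/-- Primitivity in terms of determinants can be carried through any linear bijection that preserves
unit determinants. -/
lemma isCoprime_iff_exists_det {u : Fin 2 → ℤ} :
    IsCoprime (u 0) (u 1) ↔ ∃ v, IsUnit (det u v) := by
  constructor
  · rintro ⟨x, y, h⟩
    refine ⟨![-y, x], ?_⟩
    have : det u ![-y, x] = 1 := by simp [det]; linarith
    rw [this]; exact isUnit_one
  · rintro ⟨v, h⟩
    rcases Int.isUnit_iff.1 h with h | h
    · exact ⟨v 1, -v 0, by simp only [det] at h; linarith⟩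
    · exact ⟨-v 1, v 0, by simp only [det] at h; linarith⟩

lemma isCoprime_iff_exists_pdet {u : ℤ × ℤ} :
    IsCoprime u.1 u.2 ↔ ∃ v, IsUnit (pdet u v) := by
  constructor
  · rintro ⟨x, y, h⟩
    refine ⟨(-y, x), ?_⟩
    have : pdet u (-y, x) = 1 := by simp [pdet]; linarith
    rw [this]; exact isUnit_one
  · rintro ⟨v, h⟩
    rcases Int.isUnit_iff.1 h with h | h
    · exact ⟨v.2, -v.1, by simp only [pdet] at h; linarith⟩
    · exact ⟨-v.2, v.1, by simp only [pdet] at h; linarith⟩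

lemma isUnit_pdet {u v : ℤ × ℤ} (h : IsUnit (pdet u v)) : pdet u v = 1 ∨ pdet v u = 1 := by
  rcases Int.isUnit_iff.1 h with h | h
  · exact .inl h
  · right; simp only [pdet] at h ⊢; linarith

lemma convex_of_isUnimodularSimplex {d : ℕ} {P : Set (Fin d → ℝ)} (hP : IsUnimodularSimplex P) :
    Convex ℝ P := by
  obtain ⟨v, -, rfl⟩ := hP
  exact convex_convexHull ℝ _

/-- Integral affine coordinates in which the dilate of a unimodular triangle is standard. -/
lemma exists_coordinates {P : Set (Fin 2 → ℝ)} (hP : IsUnimodularSimplex P) (n : ℕ) :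
    ∃ (φ : ℤ × ℤ ≃ (Fin 2 → ℤ)) (M : ℤ × ℤ → (Fin 2 → ℤ)), M.Surjective ∧
      (∀ p u, φ (p + u) = φ p + M u) ∧
      (∀ u v, IsUnit (det (M u) (M v)) ↔ IsUnit (pdet u v)) ∧
      ∀ p, toReal (φ p) ∈ (n : ℝ) • P ↔ p ∈ triPoints n := by
  obtain ⟨v, hv, rfl⟩ := hP
  set a := v 1 - v 0 with ha
  set b := v 2 - v 0 with hb
  set D := det a b with hDdef
  have hD : D * D = 1 := by
    have : IsUnit D := by
      rw [Matrix.det_fin_two] at hv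
      have e : D = (Matrix.of fun i j : Fin 2 => v i.succ j - v 0 j) 0 0 *
        (Matrix.of fun i j : Fin 2 => v i.succ j - v 0 j) 1 1 -
        (Matrix.of fun i j : Fin 2 => v i.succ j - v 0 j) 0 1 *
        (Matrix.of fun i j : Fin 2 => v i.succ j - v 0 j) 1 0 := by
        simp [hDdef, det, ha, hb]
      rw [e]; exact hv
    rcases Int.isUnit_iff.1 this with h | h <;> rw [h] <;> norm_num
  have hDd : D * (a 0 * b 1 - a 1 * b 0) = 1 := hD
  let M : ℤ × ℤ → (Fin 2 → ℤ) := fun p => p.1 • a + p.2 • b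
  -- Cramer's rule for the inverse of `M`; as `D * D = 1`, dividing by `D` is multiplying by it.
  let N : (Fin 2 → ℤ) → ℤ × ℤ := fun z => (D * det z b, D * det a z)
  have hNM : ∀ p, N (M p) = p := by
    rintro ⟨x, y⟩
    simp only [N, M, det, Pi.add_apply, Pi.smul_apply, smul_eq_mul, Prod.mk.injEq]
    constructor
    · linear_combination x * hDd
    · linear_combination y * hDd
  have hMN : ∀ z, M (N z) = z := by
    intro z
    funext i
    fin_cases i <;> simp [N, M, det]
    · linear_combination z 0 * hDd
    · linear_combination z 1 * hDd
  have hMadd : ∀ p q, M (p + q) = M p + M q := by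
    intro p q
    simp only [M, Prod.fst_add, Prod.snd_add, add_smul]
    abel
  refine ⟨⟨fun p => n • v 0 + M p, fun z => N (z - n • v 0), fun p => by simp [hNM],
    fun z => by simp [hMN]⟩, M, fun z => ⟨N z, hMN z⟩, fun p u => ?_, fun u w => ?_, fun p => ?_⟩
  · simp [hMadd, add_assoc]
  · have : det (M u) (M w) = D * pdet u w := by
      simp only [M, pdet, det, hDdef, Pi.add_apply, Pi.smul_apply, smul_eq_mul]
      ring
    rw [this, IsUnit.mul_iff]
    exact and_iff_right (IsUnit.of_mul_eq_one _ hD)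
  · have hDdR : (D : ℝ) * (a 0 * b 1 - a 1 * b 0) = 1 := by exact_mod_cast hDd
    have ha' : ∀ i, (a i : ℝ) = v 1 i - v 0 i := by simp [ha]
    have hb' : ∀ i, (b i : ℝ) = v 2 i - v 0 i := by simp [hb]
    constructor
    · intro h
      obtain ⟨q, hq, hqp⟩ := Set.mem_smul_set.1 h
      let f : (Fin 2 → ℝ) → ℝ := fun q => D * ((q 0 - v 0 0) * b 1 - (q 1 - v 0 1) * b 0)
      let g : (Fin 2 → ℝ) → ℝ := fun q => D * (a 0 * (q 1 - v 0 1) - a 1 * (q 0 - v 0 0))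
      have hcomb : ∀ (x y : Fin 2 → ℝ) (r s : ℝ), r + s = 1 →
          f (r • x + s • y) = r * f x + s * f y ∧ g (r • x + s • y) = r * g x + s * g y := by
        intro x y r s hrs
        obtain rfl : s = 1 - r := by linarith
        simp only [f, g, Pi.add_apply, Pi.smul_apply, smul_eq_mul]
        constructor <;> ring
      have hsub : convexHull ℝ (Set.range fun i => toReal (v i)) ⊆
          {q | 0 ≤ f q ∧ 0 ≤ g q ∧ f q + g q ≤ 1} := by
        apply convexHull_min
        · rintro _ ⟨i, rfl⟩
          have h0 : f (toReal (v 0)) = 0 ∧ g (toReal (v 0)) = 0 := by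
            simp [f, g, toReal]
          have h1 : f (toReal (v 1)) = 1 ∧ g (toReal (v 1)) = 0 := by
            simp only [f, g, toReal, ← ha']
            exact ⟨by linear_combination hDdR, by ring⟩
          have h2 : f (toReal (v 2)) = 0 ∧ g (toReal (v 2)) = 1 := by
            simp only [f, g, toReal, ← hb']
            exact ⟨by ring, by linear_combination hDdR⟩
          fin_cases i
          · simp [h0.1, h0.2]
          · simp [h1.1, h1.2]
          · simp [h2.1, h2.2]
        · rintro x ⟨h1, h2, h3⟩ y ⟨h4, h5, h6⟩ r s hr hs hrs
          obtain ⟨e1, e2⟩ := hcomb x y r s hrs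
          simp only [Set.mem_ofPred_eq, e1, e2]
          refine ⟨by positivity, by positivity, by nlinarith⟩
      obtain ⟨h1, h2, h3⟩ := hsub hq
      have hn : (0 : ℝ) ≤ n := n.cast_nonneg
      have hq' : ∀ i, (n : ℝ) * q i = n * v 0 i + (p.1 * a i + p.2 * b i) := by
        intro i
        have := congrFun hqp i
        simpa [toReal, M] using this
      have e1 : (p.1 : ℝ) = n * f q := by
        simp only [f]
        linear_combination (-(D : ℝ) * b 1) * hq' 0 + (D : ℝ) * b 0 * hq' 1 - p.1 * hDdR
      have e2 : (p.2 : ℝ) = n * g q := by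
        simp only [g]
        linear_combination (-(D : ℝ) * a 0) * hq' 1 + (D : ℝ) * a 1 * hq' 0 - p.2 * hDdR
      refine ⟨?_, ?_, ?_⟩
      · have : (0 : ℝ) ≤ p.1 := by rw [e1]; positivity
        exact_mod_cast this
      · have : (0 : ℝ) ≤ p.2 := by rw [e2]; positivity
        exact_mod_cast this
      · have : (p.1 : ℝ) + p.2 ≤ n := by rw [e1, e2]; nlinarith
        exact_mod_cast this
    · rintro ⟨h1, h2, h3⟩
      have h1' : (0 : ℝ) ≤ p.1 := by exact_mod_cast h1
      have h2' : (0 : ℝ) ≤ p.2 := by exact_mod_cast h2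
      have h3' : (p.1 : ℝ) + p.2 ≤ n := by exact_mod_cast h3
      have hmem : ∀ i, toReal (v i) ∈ convexHull ℝ (Set.range fun i => toReal (v i)) :=
        fun i => subset_convexHull ℝ _ ⟨i, rfl⟩
      -- The barycentric coordinates of the preimage have denominator `n`, so `n = 0` is separate.
      rcases Nat.eq_zero_or_pos n with rfl | hn
      · have e1 : p.1 = 0 := by push_cast at h3; omega
        have e2 : p.2 = 0 := by push_cast at h3; omega
        refine Set.mem_smul_set.2 ⟨_, hmem 0, ?_⟩
        funext i
        simp [M, e1, e2, toReal]
      · have hn' : (0 : ℝ) < n := by exact_mod_cast hn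
        refine Set.mem_smul_set.2 ⟨((n - p.1 - p.2) / n : ℝ) • toReal (v 0) +
          ((p.1 / n : ℝ) • toReal (v 1) + (p.2 / n : ℝ) • toReal (v 2)), ?_, ?_⟩
        · have := (convex_convexHull ℝ (Set.range fun i => toReal (v i))).sum_mem
            (t := Finset.univ) (w := ![((n - p.1 - p.2) / n : ℝ), p.1 / n, p.2 / n])
            (z := fun i => toReal (v i))
            (by
              intro i _
              fin_cases i
              · exact div_nonneg (by linarith) hn'.le
              · exact div_nonneg h1' hn'.le
              · exact div_nonneg h2' hn'.le)
            (by simp [Fin.sum_univ_three]; field_simp; ring)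
            (by intro i _; exact hmem i)
          simpa [Fin.sum_univ_three, add_assoc] using this
        · funext i
          simp [M, toReal, ha', hb']
          field_simp
          ring

lemma finite_triPoints (n : ℕ) : (triPoints n).Finite := by
  refine (Set.Finite.prod (Set.finite_Icc (0 : ℤ) n) (Set.finite_Icc (0 : ℤ) n)).subset ?_
  rintro ⟨x, y⟩ ⟨h1, h2, h3⟩
  simp only [Set.mem_prod, Set.mem_Icc] at *
  omega

/-! ### Reduction to counting in the standard triangle -/

section Transfer

variable {P : Set (Fin 2 → ℝ)} {n : ℕ}

lemma freePolytopes_eq_image_coordinates (hP : IsUnimodularSimplex P)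
    {φ : ℤ × ℤ ≃ (Fin 2 → ℤ)} (h : ∀ p, toReal (φ p) ∈ (n : ℝ) • P ↔ p ∈ triPoints n) (i : ℕ) :
    freePolytopes i ((n : ℝ) • P) = (fun S : Finset (ℤ × ℤ) => hull (S.map φ.toEmbedding)) ''
      {S | (∀ p ∈ S, p ∈ triPoints n) ∧ FreeSet (S.map φ.toEmbedding) ∧
        (S.map φ.toEmbedding).card = i} := by
  rw [freePolytopes_eq_image i ((convex_of_isUnimodularSimplex hP).smul _)]
  ext Q
  constructor
  · rintro ⟨s, ⟨h1, h2, h3⟩, rfl⟩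
    have e : (s.map φ.symm.toEmbedding).map φ.toEmbedding = s := by
      ext; simp
    refine ⟨s.map φ.symm.toEmbedding, ⟨?_, ?_⟩, by simp only [e]⟩
    · intro p hp
      rw [← h]
      apply h2
      simpa using hp
    · rw [e]; exact ⟨h1, h3⟩
  · rintro ⟨S, ⟨h1, h2, h3⟩, rfl⟩
    refine ⟨_, ⟨h2, ?_, h3⟩, rfl⟩
    intro z hz
    obtain ⟨p, hp, rfl⟩ := Finset.mem_map.1 hz
    exact (h p).2 (h1 p hp)

lemma finite_freePolytopes (hP : IsUnimodularSimplex P) (i : ℕ) :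
    (freePolytopes i ((n : ℝ) • P)).Finite := by
  obtain ⟨φ, M, -, -, -, h⟩ := exists_coordinates hP n
  rw [freePolytopes_eq_image_coordinates hP h]
  apply Set.Finite.image
  apply ((finite_triPoints n).toFinset.powerset.finite_toSet).subset
  rintro S ⟨hS, -⟩
  simp only [Finset.coe_powerset, Set.mem_preimage, Set.mem_powerset_iff, Set.Finite.coe_toFinset]
  exact hS

lemma alpha_eq_ncard (hP : IsUnimodularSimplex P)
    {φ : ℤ × ℤ ≃ (Fin 2 → ℤ)} (h : ∀ p, toReal (φ p) ∈ (n : ℝ) • P ↔ p ∈ triPoints n) (i : ℕ) :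
    alpha i P n = {S : Finset (ℤ × ℤ) | (∀ p ∈ S, p ∈ triPoints n) ∧
      FreeSet (S.map φ.toEmbedding) ∧ (S.map φ.toEmbedding).card = i}.ncard := by
  rw [alpha, freePolytopes_eq_image_coordinates hP h]
  apply Set.InjOn.ncard_image
  intro S hS S' hS' e
  exact Finset.map_injective _ (hull_injOn hS.2.1 hS'.2.1 e)

lemma alpha_eq_zero (hP : IsUnimodularSimplex P) {i : ℕ} (hi : 4 < i) : alpha i P n = 0 := by
  obtain ⟨φ, M, -, -, -, h⟩ := exists_coordinates hP n
  rw [alpha_eq_ncard hP h]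
  convert Set.ncard_empty (Finset (ℤ × ℤ))
  refine Set.eq_empty_of_forall_notMem ?_
  rintro S ⟨-, h1, h2⟩
  have := h1.card_le
  omega

lemma alpha_one_eq (hP : IsUnimodularSimplex P) : alpha 1 P n = (triPoints n).ncard := by
  obtain ⟨φ, M, -, -, -, h⟩ := exists_coordinates hP n
  rw [alpha_eq_ncard hP h, ← Set.ncard_image_of_injective _ (Finset.singleton_injective (α := ℤ × ℤ))]
  congr 1
  ext S
  simp only [Set.mem_ofPred_eq, Set.mem_image, freeSet_card_one]
  constructor
  · rintro ⟨hS, p, hp⟩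
    obtain ⟨q, rfl⟩ := Finset.card_eq_one.1
      (by rw [← Finset.card_map φ.toEmbedding, hp]; rfl : S.card = 1)
    exact ⟨q, hS q (by simp), rfl⟩
  · rintro ⟨q, hq, rfl⟩
    exact ⟨by simpa using hq, φ q, by simp⟩

lemma alpha_two_eq (hP : IsUnimodularSimplex P) : alpha 2 P n = (segments n).ncard := by
  obtain ⟨φ, M, hM, hadd, hdet, h⟩ := exists_coordinates hP n
  rw [alpha_eq_ncard hP h]
  congr 1
  ext S
  simp only [Set.mem_ofPred_eq, segments, freeSet_card_two, isCoprime_iff_exists_det,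
    isCoprime_iff_exists_pdet]
  refine and_congr_right fun _ => ?_
  constructor
  · rintro ⟨p, u, ⟨w, hw⟩, e⟩
    obtain ⟨u, rfl⟩ := hM u
    obtain ⟨w, rfl⟩ := hM w
    obtain ⟨p, rfl⟩ := φ.surjective p
    refine ⟨p, u, ⟨w, (hdet _ _).1 hw⟩, Finset.map_injective φ.toEmbedding ?_⟩
    simp [e, hadd]
  · rintro ⟨p, u, ⟨w, hw⟩, rfl⟩
    exact ⟨φ p, M u, ⟨M w, (hdet _ _).2 hw⟩, by simp [hadd]⟩

lemma alpha_three_eq (hP : IsUnimodularSimplex P) : alpha 3 P n = (triangles n).ncard := by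
  obtain ⟨φ, M, hM, hadd, hdet, h⟩ := exists_coordinates hP n
  rw [alpha_eq_ncard hP h]
  congr 1
  ext S
  simp only [Set.mem_ofPred_eq, triangles, freeSet_card_three]
  refine and_congr_right fun _ => ?_
  constructor
  · rintro ⟨p, u, v, hw, e⟩
    obtain ⟨u, rfl⟩ := hM u
    obtain ⟨v, rfl⟩ := hM v
    obtain ⟨p, rfl⟩ := φ.surjective p
    have hS : S = {p, p + u, p + v} := by
      apply Finset.map_injective φ.toEmbedding
      simp [e, hadd]
    rcases isUnit_pdet ((hdet _ _).1 hw) with h1 | h1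
    · exact ⟨p, u, v, h1, hS⟩
    · exact ⟨p, v, u, h1, by rw [hS]; ext; simp; tauto⟩
  · rintro ⟨p, u, v, hw, rfl⟩
    exact ⟨φ p, M u, M v, (hdet _ _).2 (hw ▸ isUnit_one), by simp [hadd]⟩

lemma alpha_four_eq (hP : IsUnimodularSimplex P) : alpha 4 P n = (parallelograms n).ncard := by
  obtain ⟨φ, M, hM, hadd, hdet, h⟩ := exists_coordinates hP n
  rw [alpha_eq_ncard hP h]
  congr 1
  ext S
  simp only [Set.mem_ofPred_eq, parallelograms, freeSet_card_four]
  refine and_congr_right fun _ => ?_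
  constructor
  · rintro ⟨p, u, v, hw, e⟩
    obtain ⟨u, rfl⟩ := hM u
    obtain ⟨v, rfl⟩ := hM v
    obtain ⟨p, rfl⟩ := φ.surjective p
    have hS : S = {p, p + u, p + v, p + u + v} := by
      apply Finset.map_injective φ.toEmbedding
      simp [e, hadd]
    rcases isUnit_pdet ((hdet _ _).1 hw) with h1 | h1
    · exact ⟨p, u, v, h1, hS⟩
    · refine ⟨p, v, u, h1, ?_⟩
      rw [hS, add_right_comm p v u]
      ext; simp; tauto
  · rintro ⟨p, u, v, hw, rfl⟩
    exact ⟨φ p, M u, M v, (hdet _ _).2 (hw ▸ isUnit_one), by simp [hadd]⟩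

end Transfer

/-! ### The threefold symmetry and the hexagonal norm -/

/-- The `k`-th power of the rotation `(x, y) ↦ (n - x - y, x)` of the standard triangle of
size `n`; for `n = 0` this is the linear part. -/
def rot (n : ℤ) (k : Fin 3) (p : ℤ × ℤ) : ℤ × ℤ :=
  ![p, (n - p.1 - p.2, p.1), (p.2, n - p.1 - p.2)] k

@[simp] lemma rot_zero (n : ℤ) (p : ℤ × ℤ) : rot n 0 p = p := rfl
@[simp] lemma rot_one (n : ℤ) (p : ℤ × ℤ) : rot n 1 p = (n - p.1 - p.2, p.1) := rfl
@[simp] lemma rot_two (n : ℤ) (p : ℤ × ℤ) : rot n 2 p = (p.2, n - p.1 - p.2) := rfl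

lemma rot_add (n : ℤ) (k : Fin 3) (p d : ℤ × ℤ) : rot n k (p + d) = rot n k p + rot 0 k d := by
  fin_cases k <;> simp [Prod.ext_iff] <;> omega

lemma rot_sub (n : ℤ) (k : Fin 3) (p q : ℤ × ℤ) : rot n k p - rot n k q = rot 0 k (p - q) := by
  fin_cases k <;> simp [Prod.ext_iff] <;> omega

lemma rot_surjective (n : ℤ) (k : Fin 3) : (rot n k).Surjective := by
  intro p
  fin_cases k
  · exact ⟨p, rfl⟩
  · exact ⟨rot n 2 p, by ext <;> simp⟩
  · exact ⟨rot n 1 p, by ext <;> simp; omega⟩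

lemma rot_injective (n : ℤ) (k : Fin 3) : (rot n k).Injective := by
  intro p q h
  fin_cases k <;> simp [Prod.ext_iff] at h ⊢ <;> omega

lemma pdet_rot (k : Fin 3) (u v : ℤ × ℤ) : pdet (rot 0 k u) (rot 0 k v) = pdet u v := by
  fin_cases k <;> simp [pdet] <;> ring

lemma rot_mem_triPoints {n : ℕ} {k : Fin 3} {p : ℤ × ℤ} :
    rot n k p ∈ triPoints n ↔ p ∈ triPoints n := by
  fin_cases k <;> simp [triPoints] <;> omega

/-- The norm on `ℤ²` whose unit ball is the hexagon spanned by the edges of the triangle. -/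
def hex (d : ℤ × ℤ) : ℤ := max (max d.1 (-d.1)) (max (max d.2 (-d.2)) (max (d.1 + d.2) (-d.1 - d.2)))

lemma hex_rot (k : Fin 3) (d : ℤ × ℤ) : hex (rot 0 k d) = hex d := by
  fin_cases k <;> simp [hex] <;> omega

lemma hex_of_nonneg {d : ℤ × ℤ} (h1 : 0 ≤ d.1) (h2 : 0 ≤ d.2) : hex d = d.1 + d.2 := by
  simp only [hex]; omega

/-- The three rotations and the sign cut the punctured plane into six half-open sectors, images of
the half-open quadrant. -/
lemma exists_rot_eq {u : ℤ × ℤ} (hu : u ≠ 0) : ∃ (k : Fin 3) (d : ℤ × ℤ), 1 ≤ d.1 ∧ 0 ≤ d.2 ∧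
    (u = rot 0 k d ∨ u = - rot 0 k d) := by
  have hu' : ¬ (u.1 = 0 ∧ u.2 = 0) := fun h => hu (Prod.ext h.1 h.2)
  have : (1 ≤ u.1 ∧ 0 ≤ u.2) ∨ (u.1 ≤ -1 ∧ u.2 ≤ 0) ∨ (1 ≤ u.2 ∧ u.1 + u.2 ≤ 0) ∨
      (u.2 ≤ -1 ∧ 0 ≤ u.1 + u.2) ∨ (0 ≤ u.1 ∧ u.1 + u.2 ≤ -1) ∨ (u.1 ≤ 0 ∧ 1 ≤ u.1 + u.2) := by
    omega
  rcases this with h | h | h | h | h | h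
  · exact ⟨0, u, h.1, h.2, .inl rfl⟩
  · exact ⟨0, -u, by simp; omega, by simp; omega, .inr (by simp)⟩
  · exact ⟨1, (u.2, -u.1 - u.2), h.1, by simp; omega, .inl (by ext <;> simp; omega)⟩
  · exact ⟨1, (-u.2, u.1 + u.2), by simp; omega, by simp; omega, .inr (by ext <;> simp)⟩
  · exact ⟨2, (-u.1 - u.2, u.1), by simp; omega, by simp; omega, .inl (by ext <;> simp)⟩
  · exact ⟨2, (u.1 + u.2, -u.1), by simp; omega, by simp; omega, .inr (by ext <;> simp)⟩

lemma isCoprime_rot {k : Fin 3} {d : ℤ × ℤ} :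
    IsCoprime (rot 0 k d).1 (rot 0 k d).2 ↔ IsCoprime d.1 d.2 := by
  rw [isCoprime_iff_exists_pdet, isCoprime_iff_exists_pdet]
  constructor
  · rintro ⟨v, hv⟩
    obtain ⟨v, rfl⟩ := rot_surjective 0 k v
    exact ⟨v, by rwa [pdet_rot] at hv⟩
  · rintro ⟨v, hv⟩
    exact ⟨rot 0 k v, by rwa [pdet_rot]⟩

/-! ### Counting segments -/

/-- Primitive vectors `d` in the half-open quadrant, placed at `p` in the triangle. -/
def directed (n : ℕ) : Set ((ℤ × ℤ) × (ℤ × ℤ)) :=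
  {x | (0 ≤ x.1.1 ∧ 0 ≤ x.1.2 ∧ x.1.1 + x.1.2 + (x.2.1 + x.2.2) ≤ n) ∧
    1 ≤ x.2.1 ∧ 0 ≤ x.2.2 ∧ IsCoprime x.2.1 x.2.2}

lemma mem_directed {n : ℕ} {p d : ℤ × ℤ} (hp : p ∈ triPoints n) (hpd : p + d ∈ triPoints n)
    (h1 : 1 ≤ d.1) (h2 : 0 ≤ d.2) (h : IsCoprime d.1 d.2) : (p, d) ∈ directed n := by
  simp only [triPoints, directed, Set.mem_ofPred_eq, Prod.fst_add, Prod.snd_add] at *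
  exact ⟨⟨hp.1, hp.2.1, by omega⟩, h1, h2, h⟩

/-- A pair of points that are rotated from a directed segment determines that segment. -/
lemma rot_pair_injective {n : ℤ} {k k' : Fin 3} {p d p' d' : ℤ × ℤ} (h1 : 1 ≤ d.1) (h2 : 0 ≤ d.2)
    (h1' : 1 ≤ d'.1) (h2' : 0 ≤ d'.2)
    (h : (rot n k p = rot n k' p' ∧ rot n k (p + d) = rot n k' (p' + d')) ∨
      (rot n k p = rot n k' (p' + d') ∧ rot n k (p + d) = rot n k' p')) :
    k = k' ∧ p = p' ∧ d = d' := by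
  fin_cases k <;> fin_cases k' <;> simp [Prod.ext_iff] at h ⊢ <;> omega

lemma finset_pair_eq_pair {α : Type*} [DecidableEq α] {a b c d : α}
    (h : ({a, b} : Finset α) = {c, d}) : (a = c ∧ b = d) ∨ (a = d ∧ b = c) := by
  rw [← Finset.coe_inj] at h
  simpa [Set.pair_eq_pair_iff] using h

lemma segments_eq_image (n : ℕ) : segments n =
    (fun x : Fin 3 × ((ℤ × ℤ) × (ℤ × ℤ)) =>
      ({rot n x.1 x.2.1, rot n x.1 (x.2.1 + x.2.2)} : Finset (ℤ × ℤ))) ''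
      (Set.univ ×ˢ directed n) := by
  ext S
  constructor
  · rintro ⟨hS, p, u, hu, rfl⟩
    have key : ∀ (k : Fin 3) (q d : ℤ × ℤ), 1 ≤ d.1 → 0 ≤ d.2 → IsCoprime d.1 d.2 →
        ({p, p + u} : Finset (ℤ × ℤ)) = {q, q + rot 0 k d} →
        ∃ x ∈ Set.univ ×ˢ directed n, (fun x : Fin 3 × ((ℤ × ℤ) × (ℤ × ℤ)) =>
          ({rot n x.1 x.2.1, rot n x.1 (x.2.1 + x.2.2)} : Finset (ℤ × ℤ))) x =
          {p, p + u} := by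
      intro k q d h1 h2 h3 e
      obtain ⟨q, rfl⟩ := rot_surjective n k q
      rw [← rot_add] at e
      rw [e] at hS
      refine ⟨(k, q, d), ⟨trivial, mem_directed ?_ ?_ h1 h2 h3⟩, e.symm⟩
      · exact rot_mem_triPoints.1 (hS (rot n k q) (by simp))
      · exact rot_mem_triPoints.1 (hS (rot n k (q + d)) (by simp))
    have hu0 : u ≠ 0 := by rintro rfl; exact not_isCoprime_zero_zero hu
    obtain ⟨k, d, h1, h2, rfl | rfl⟩ := exists_rot_eq hu0
    · exact key k p d h1 h2 (isCoprime_rot.1 hu) rfl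
    -- A negative sign is absorbed by starting from the other endpoint.
    · refine key k (p + -rot 0 k d) d h1 h2 (isCoprime_rot (k := k).1 ?_) ?_
      · simpa using hu.neg_neg
      · rw [neg_add_cancel_right, Finset.pair_comm]
  · rintro ⟨⟨k, p, d⟩, ⟨-, ⟨h1, h2, h3⟩, h4, h5, h6⟩, rfl⟩
    refine ⟨?_, rot n k p, rot 0 k d, isCoprime_rot.2 h6, by simp [rot_add]⟩
    simp only [Finset.mem_insert, Finset.mem_singleton]
    rintro q (rfl | rfl) <;> rw [rot_mem_triPoints] <;>
      simp only [triPoints, Set.mem_ofPred_eq, Prod.fst_add, Prod.snd_add] at * <;> omega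

lemma ncard_segments (n : ℕ) : (segments n).ncard = 3 * (directed n).ncard := by
  rw [segments_eq_image, Set.InjOn.ncard_image, Set.ncard_prod]
  · simp
  · rintro ⟨k, p, d⟩ ⟨-, -, h1, h2, -⟩ ⟨k', p', d'⟩ ⟨-, -, h1', h2', -⟩ h
    obtain ⟨rfl, rfl, rfl⟩ := rot_pair_injective h1 h2 h1' h2' (finset_pair_eq_pair h)
    rfl

/-! ### Farey parents -/

lemma pos_of_pdet_eq_one {u v : ℤ × ℤ} (h1 : 0 ≤ u.1) (h2 : 0 ≤ u.2) (h3 : 0 ≤ v.1) (h4 : 0 ≤ v.2)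
    (h : pdet u v = 1) : 1 ≤ u.1 ∧ 1 ≤ v.2 := by
  simp only [pdet] at h
  have : 0 < u.1 * v.2 := by nlinarith [mul_nonneg h2 h3]
  constructor
  · exact pos_of_mul_pos_left this h4
  · exact pos_of_mul_pos_right this h1

/-- A primitive vector of the open quadrant is the sum of its two Farey parents. -/
lemma exists_parents {d : ℤ × ℤ} (h1 : 1 ≤ d.1) (h2 : 1 ≤ d.2) (h : IsCoprime d.1 d.2) :
    ∃ u v : ℤ × ℤ, 0 ≤ u.1 ∧ 0 ≤ u.2 ∧ 0 ≤ v.1 ∧ 0 ≤ v.2 ∧ pdet u v = 1 ∧ u + v = d := by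
  obtain ⟨x, y, hxy⟩ := h
  have hd : 0 < d.1 := by omega
  have e0 := Int.mul_ediv_add_emod (y - 1) d.1
  have e1 := Int.emod_nonneg (y - 1) hd.ne'
  have e2 := Int.emod_lt_of_pos (y - 1) hd
  -- Solutions of `pdet u d = 1` form a progression with step `d`; this `t` brings `u.1` into `[1,
  -- d.1]`, and the equation then confines `u.2` to `[0, d.2]`.
  set t := (y - 1) / d.1 with ht
  have a1 : 1 ≤ y - t * d.1 := by nlinarith
  have a2 : y - t * d.1 ≤ d.1 := by nlinarith
  have e : (y - t * d.1) * d.2 - (-x - t * d.2) * d.1 = 1 := by linear_combination hxy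
  have b1 : 0 ≤ -x - t * d.2 := by
    by_contra! hc
    nlinarith
  have b2 : -x - t * d.2 ≤ d.2 := by
    by_contra! hc
    nlinarith
  refine ⟨(y - t * d.1, -x - t * d.2), (d.1 - (y - t * d.1), d.2 - (-x - t * d.2)), by simp; omega,
    by simp; omega, by simp; omega, by simp; omega, ?_, by ext <;> simp⟩
  simp only [pdet]
  linear_combination e

/-- Both `u` and `u'` have determinant 1 with the common sum, so `u' = u + β (u + v)`. A positive
`β` makes `v'.1` negative, a negative one makes `u'.2` negative. -/
lemma parents_unique {u v u' v' : ℤ × ℤ} (hu1 : 0 ≤ u.1) (hu2 : 0 ≤ u.2) (hv1 : 0 ≤ v.1)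
    (hv2 : 0 ≤ v.2) (h : pdet u v = 1) (hu2' : 0 ≤ u'.2) (hv1' : 0 ≤ v'.1)
    (h' : pdet u' v' = 1) (e : u + v = u' + v') : u = u' ∧ v = v' := by
  obtain ⟨a1, a2⟩ := pos_of_pdet_eq_one hu1 hu2 hv1 hv2 h
  have e1 : v'.1 = u.1 + v.1 - u'.1 := by have := congrArg Prod.fst e; simp at this; omega
  have e2 : v'.2 = u.2 + v.2 - u'.2 := by have := congrArg Prod.snd e; simp at this; omega
  set β := pdet u u' with hβ
  simp only [pdet] at h h' hβ
  rw [e1, e2] at h'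
  have k1 : u'.1 = u.1 + β * (u.1 + v.1) := by
    rw [hβ]; linear_combination (-u'.1) * h + u.1 * h'
  have k2 : u'.2 = u.2 + β * (u.2 + v.2) := by
    rw [hβ]; linear_combination (-u'.2) * h + u.2 * h'
  have hβ0 : β = 0 := by
    rcases lt_trichotomy β 0 with hlt | h0 | hgt
    · nlinarith
    · exact h0
    · nlinarith
  rw [hβ0] at k1 k2
  exact ⟨Prod.ext (by omega) (by omega), Prod.ext (by omega) (by omega)⟩

/-- Positively oriented bases `u, v` of `ℤ²` in the closed quadrant, placed at a point `p` such
that `p` and `p + u + v` lie in the triangle. -/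
def bases (n : ℕ) : Set ((ℤ × ℤ) × (ℤ × ℤ) × (ℤ × ℤ)) :=
  {x | (0 ≤ x.1.1 ∧ 0 ≤ x.1.2 ∧
      x.1.1 + x.1.2 + (x.2.1.1 + x.2.2.1 + (x.2.1.2 + x.2.2.2)) ≤ n) ∧
    (0 ≤ x.2.1.1 ∧ 0 ≤ x.2.1.2) ∧ (0 ≤ x.2.2.1 ∧ 0 ≤ x.2.2.2) ∧ pdet x.2.1 x.2.2 = 1}

lemma injOn_bases (n : ℕ) : Set.InjOn
    (fun x : (ℤ × ℤ) × (ℤ × ℤ) × (ℤ × ℤ) => (x.1, x.2.1 + x.2.2)) (bases n) := by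
  rintro ⟨p, u, v⟩ ⟨-, h2, h3, h4⟩ ⟨p', u', v'⟩ ⟨-, h2', h3', h4'⟩ e
  obtain ⟨rfl, e⟩ := Prod.mk.inj e
  obtain ⟨rfl, rfl⟩ := parents_unique h2.1 h2.2 h3.1 h3.2 h4 h2'.2 h3'.1 h4' e
  rfl

lemma image_bases (n : ℕ) :
    (fun x : (ℤ × ℤ) × (ℤ × ℤ) × (ℤ × ℤ) => (x.1, x.2.1 + x.2.2)) '' bases n =
      {x ∈ directed n | 1 ≤ x.2.2} := by
  ext ⟨p, d⟩
  constructor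
  · rintro ⟨⟨p, u, v⟩, ⟨h1, h2, h3, h4⟩, e⟩
    obtain ⟨rfl, rfl⟩ := Prod.mk.inj e
    obtain ⟨a1, a2⟩ := pos_of_pdet_eq_one h2.1 h2.2 h3.1 h3.2 h4
    simp only [directed, Set.mem_ofPred_eq, Prod.fst_add, Prod.snd_add] at *
    refine ⟨⟨h1, by omega, by omega, v.2, -v.1, ?_⟩, by omega⟩
    simp only [pdet] at h4
    linear_combination h4
  · rintro ⟨⟨h1, h2, h3, h4⟩, h5⟩
    obtain ⟨u, v, a1, a2, a3, a4, h, rfl⟩ := exists_parents h2 h5 h4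
    exact ⟨(p, u, v), ⟨h1, ⟨a1, a2⟩, ⟨a3, a4⟩, h⟩, rfl⟩

lemma ncard_bases (n : ℕ) : (bases n).ncard = {x ∈ directed n | 1 ≤ x.2.2}.ncard := by
  rw [← image_bases, (injOn_bases n).ncard_image]

/-! ### Parallelograms, their halves and their long diagonals -/

/-- The rotated parallelogram spanned by a based pair of vectors. -/
def quad (n : ℕ) (x : Fin 3 × (ℤ × ℤ) × (ℤ × ℤ) × (ℤ × ℤ)) : Finset (ℤ × ℤ) :=
  {rot n x.1 x.2.1, rot n x.1 (x.2.1 + x.2.2.1), rot n x.1 (x.2.1 + x.2.2.2),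
    rot n x.1 (x.2.1 + x.2.2.1 + x.2.2.2)}

/-- The half of the parallelogram `quad` on one side of its long diagonal. -/
def halfQuad (n : ℕ) (x : (Fin 3 × (ℤ × ℤ) × (ℤ × ℤ) × (ℤ × ℤ)) × Bool) : Finset (ℤ × ℤ) :=
  {rot n x.1.1 x.1.2.1, rot n x.1.1 (x.1.2.1 + x.1.2.2.1 + x.1.2.2.2),
    rot n x.1.1 (x.1.2.1 + bif x.2 then x.1.2.2.1 else x.1.2.2.2)}

lemma halfQuad_subset (n : ℕ) (x : Fin 3 × (ℤ × ℤ) × (ℤ × ℤ) × (ℤ × ℤ)) (b : Bool) :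
    halfQuad n (x, b) ⊆ quad n x := by
  cases b <;> intro z <;> simp [halfQuad, quad] <;> tauto

/-- Two vertices of a parallelogram that are as far apart as its long diagonal are the ends of
the long diagonal. -/
lemma eq_diagonal_of_mem_quad {n : ℕ} {k : Fin 3} {p u v : ℤ × ℤ} (hu1 : 0 ≤ u.1) (hu2 : 0 ≤ u.2)
    (hv1 : 0 ≤ v.1) (hv2 : 0 ≤ v.2) (h : pdet u v = 1) {x y : ℤ × ℤ} (hx : x ∈ quad n (k, p, u, v))
    (hy : y ∈ quad n (k, p, u, v)) (hxy : u.1 + v.1 + (u.2 + v.2) ≤ hex (y - x)) :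
    (x = rot n k p ∧ y = rot n k (p + (u + v))) ∨ (x = rot n k (p + (u + v)) ∧ y = rot n k p) := by
  obtain ⟨a1, a2⟩ := pos_of_pdet_eq_one hu1 hu2 hv1 hv2 h
  obtain ⟨x, rfl⟩ := rot_surjective n k x
  obtain ⟨y, rfl⟩ := rot_surjective n k y
  rw [rot_sub, hex_rot] at hxy
  simp only [quad, Finset.mem_insert, Finset.mem_singleton, (rot_injective n k).eq_iff] at hx hy ⊢
  simp only [hex, Prod.fst_sub, Prod.snd_sub] at hxy
  -- The sides and the short diagonal have smaller hexagonal norm than `u + v`.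
  rcases hx with rfl | rfl | rfl | rfl <;> rcases hy with rfl | rfl | rfl | rfl <;>
    (try simp only [Prod.fst_add, Prod.snd_add] at hxy) <;> first
    | (exfalso; omega)
    | simp [add_assoc]

/-- A parallelogram is determined by any other one that contains its long diagonal and is not
larger. -/
lemma eq_of_diagonal_mem_quad {n : ℕ} {x x' : Fin 3 × (ℤ × ℤ) × (ℤ × ℤ) × (ℤ × ℤ)}
    (hx : x.2 ∈ bases n) (hx' : x'.2 ∈ bases n) (h1 : rot n x.1 x.2.1 ∈ quad n x')
    (h2 : rot n x.1 (x.2.1 + x.2.2.1 + x.2.2.2) ∈ quad n x')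
    (hle : x'.2.2.1.1 + x'.2.2.2.1 + (x'.2.2.1.2 + x'.2.2.2.2) ≤
      x.2.2.1.1 + x.2.2.2.1 + (x.2.2.1.2 + x.2.2.2.2)) : x = x' := by
  obtain ⟨k, p, u, v⟩ := x
  obtain ⟨k', p', u', v'⟩ := x'
  obtain ⟨-, hu, hv, h⟩ := hx
  obtain ⟨-, hu', hv', h'⟩ := hx'
  simp only at *
  obtain ⟨a1, a2⟩ := pos_of_pdet_eq_one hu.1 hu.2 hv.1 hv.2 h
  obtain ⟨a1', a2'⟩ := pos_of_pdet_eq_one hu'.1 hu'.2 hv'.1 hv'.2 h'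
  rw [add_assoc] at h2
  have key := eq_diagonal_of_mem_quad hu'.1 hu'.2 hv'.1 hv'.2 h' h1 h2 (by
    rw [rot_sub, hex_rot, add_sub_cancel_left, hex_of_nonneg (by simp; omega) (by simp; omega)]
    simpa using hle)
  obtain ⟨rfl, rfl, e⟩ := rot_pair_injective (by simp; omega) (by simp; omega) (by simp; omega)
    (by simp; omega) key
  obtain ⟨rfl, rfl⟩ := parents_unique hu.1 hu.2 hv.1 hv.2 h hu'.2 hv'.1 h' e
  rfl

/-- Of two equal parallelograms, take the one whose parameters give the longer diagonal; the ends of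
that diagonal lie in the other, so `eq_of_diagonal_mem_quad` applies. -/
lemma quad_injOn (n : ℕ) : Set.InjOn (quad n) (Set.univ ×ˢ bases n) := by
  have key : ∀ x x', x.2 ∈ bases n → x'.2 ∈ bases n → quad n x = quad n x' →
      x'.2.2.1.1 + x'.2.2.2.1 + (x'.2.2.1.2 + x'.2.2.2.2) ≤
      x.2.2.1.1 + x.2.2.2.1 + (x.2.2.1.2 + x.2.2.2.2) → x = x' := fun x x' hx hx' h hle =>
    eq_of_diagonal_mem_quad hx hx' (h ▸ by simp [quad]) (h ▸ by simp [quad]) hle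
  rintro x ⟨-, hx⟩ x' ⟨-, hx'⟩ h
  rcases le_total (x'.2.2.1.1 + x'.2.2.2.1 + (x'.2.2.1.2 + x'.2.2.2.2))
    (x.2.2.1.1 + x.2.2.2.1 + (x.2.2.1.2 + x.2.2.2.2)) with hle | hle
  · exact key x x' hx hx' h hle
  · exact (key x' x hx' hx h.symm hle).symm

/-- Each half contains the long diagonal, which recovers the parallelogram as in `quad_injOn`; the
third vertex then tells the halves apart. -/
lemma halfQuad_injOn (n : ℕ) : Set.InjOn (halfQuad n) ((Set.univ ×ˢ bases n) ×ˢ Set.univ) := by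
  have key : ∀ x x' b b', x.2 ∈ bases n → x'.2 ∈ bases n → halfQuad n (x, b) = halfQuad n (x', b') →
      x'.2.2.1.1 + x'.2.2.2.1 + (x'.2.2.1.2 + x'.2.2.2.2) ≤
      x.2.2.1.1 + x.2.2.2.1 + (x.2.2.1.2 + x.2.2.2.2) → x = x' := fun x x' b b' hx hx' h hle =>
    eq_of_diagonal_mem_quad hx hx' (halfQuad_subset n x' b' (h ▸ by simp [halfQuad]))
      (halfQuad_subset n x' b' (h ▸ by simp [halfQuad])) hle
  rintro ⟨x, b⟩ ⟨⟨-, hx⟩, -⟩ ⟨x', b'⟩ ⟨⟨-, hx'⟩, -⟩ h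
  have e : x = x' := by
    rcases le_total (x'.2.2.1.1 + x'.2.2.2.1 + (x'.2.2.1.2 + x'.2.2.2.2))
      (x.2.2.1.1 + x.2.2.2.1 + (x.2.2.1.2 + x.2.2.2.2)) with hle | hle
    · exact key x x' b b' hx hx' h hle
    · exact (key x' x b' b hx' hx h.symm hle).symm
  subst e
  obtain ⟨k, p, u, v⟩ := x
  obtain ⟨-, hu, hv, hdet⟩ := hx
  obtain ⟨a1, a2⟩ := pos_of_pdet_eq_one hu.1 hu.2 hv.1 hv.2 hdet
  simp only at *
  have aux : halfQuad n ((k, p, u, v), true) ≠ halfQuad n ((k, p, u, v), false) := by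
    intro h
    have hmem : rot n k (p + u) ∈ halfQuad n ((k, p, u, v), false) := by
      rw [← h]; simp [halfQuad]
    simp only [halfQuad, cond_false, Finset.mem_insert, Finset.mem_singleton,
      (rot_injective n k).eq_iff] at hmem
    rcases hmem with e | e | e
    · have : u = 0 := by simpa using e
      rw [this] at a1; simp at a1
    · have : v = 0 := by simpa using e
      rw [this] at a2; simp at a2
    · have : u = v := by simpa using e
      rw [this, pdet, mul_comm] at hdet
      simp at hdet
  cases b <;> cases b' <;> first | rfl | exact absurd h aux | exact absurd h.symm aux

/-! ### Classification by the longest segment -/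

/-- Any three distinct points of the set span a triangle of area one half. -/
def Unimodular (S : Finset (ℤ × ℤ)) : Prop :=
  ∀ x ∈ S, ∀ y ∈ S, ∀ z ∈ S, x ≠ y → x ≠ z → y ≠ z → IsUnit (pdet (y - x) (z - x))

lemma unimodular_parallelogram {p u v : ℤ × ℤ} (h : pdet u v = 1) :
    Unimodular {p, p + u, p + v, p + u + v} := by
  intro x hx y hy z hz hxy hxz hyz
  simp only [Finset.mem_insert, Finset.mem_singleton] at hx hy hz
  simp only [pdet] at h
  rw [Int.isUnit_iff]
  rcases hx with rfl | rfl | rfl | rfl <;> rcases hy with rfl | rfl | rfl | rfl <;>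
    rcases hz with rfl | rfl | rfl | rfl <;> first
    | exact absurd rfl hxy
    | exact absurd rfl hxz
    | exact absurd rfl hyz
    | (left; simp only [pdet, Prod.fst_sub, Prod.snd_sub, Prod.fst_add, Prod.snd_add]
       linear_combination h)
    | (right; simp only [pdet, Prod.fst_sub, Prod.snd_sub, Prod.fst_add, Prod.snd_add]
       linear_combination -h)

lemma Unimodular.subset {S R : Finset (ℤ × ℤ)} (hS : Unimodular S) (h : R ⊆ S) : Unimodular R :=
  fun x hx y hy z hz => hS x (h hx) y (h hy) z (h hz)

/-- In the basis `u`, `v` the coordinates of `w` differ by ±1, so `w` is `u` or `v` plus a multiple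
of `u + v`. The coordinate sum of `u + v` is `s`, and the bounds `0` and `s` leave only the multiple
zero. -/
lemma eq_parent_of_isUnit {u v w : ℤ × ℤ} (hu1 : 0 ≤ u.1) (hu2 : 0 ≤ u.2) (hv1 : 0 ≤ v.1)
    (hv2 : 0 ≤ v.2) (h : pdet u v = 1) (hw : IsUnit (pdet (u + v) w)) (h0 : 0 ≤ w.1 + w.2)
    (h1 : w.1 + w.2 ≤ u.1 + v.1 + (u.2 + v.2)) : w = u ∨ w = v := by
  obtain ⟨a1, a2⟩ := pos_of_pdet_eq_one hu1 hu2 hv1 hv2 h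
  set s := u.1 + v.1 + (u.2 + v.2) with hs
  set α := pdet w v with hα
  set β := pdet u w with hβ
  simp only [pdet, Prod.fst_add, Prod.snd_add] at h hw hα hβ
  have e1 : w.1 = α * u.1 + β * v.1 := by rw [hα, hβ]; linear_combination -w.1 * h
  have e2 : w.2 = α * u.2 + β * v.2 := by rw [hα, hβ]; linear_combination -w.2 * h
  rcases Int.isUnit_iff.1 hw with hw | hw
  · right
    have hβα : β = α + 1 := by rw [hα, hβ]; linear_combination hw
    have e3 : w.1 + w.2 = v.1 + v.2 + α * s := by rw [e1, e2, hβα, hs]; ring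
    have hα0 : α = 0 := by
      rcases lt_trichotomy α 0 with hlt | h0 | hgt
      · nlinarith
      · exact h0
      · nlinarith
    rw [hβα, hα0] at e1 e2
    exact Prod.ext (by omega) (by omega)
  · left
    have hαβ : α = β + 1 := by rw [hα, hβ]; linear_combination -hw
    have e3 : w.1 + w.2 = u.1 + u.2 + β * s := by rw [e1, e2, hαβ, hs]; ring
    have hβ0 : β = 0 := by
      rcases lt_trichotomy β 0 with hlt | h0 | hgt
      · nlinarith
      · exact h0
      · nlinarith
    rw [hαβ, hβ0] at e1 e2
    exact Prod.ext (by omega) (by omega)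

lemma hex_neg (d : ℤ × ℤ) : hex (-d) = hex d := by
  simp only [hex, Prod.fst_neg, Prod.snd_neg]; omega

/-- A unimodular set that is not contained in the small hexagon lies in the parallelogram whose
long diagonal is the longest segment of the set. -/
lemma Unimodular.subset_quad {n : ℕ} {S : Finset (ℤ × ℤ)} (hS : Unimodular S) (hc : 3 ≤ S.card)
    (hT : ∀ p ∈ S, p ∈ triPoints n) :
    (∀ x ∈ S, ∀ y ∈ S, hex (y - x) ≤ 1) ∨ ∃ x : Fin 3 × (ℤ × ℤ) × (ℤ × ℤ) × (ℤ × ℤ),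
      x.2 ∈ bases n ∧ rot n x.1 x.2.1 ∈ S ∧ rot n x.1 (x.2.1 + x.2.2.1 + x.2.2.2) ∈ S ∧
      S ⊆ quad n x := by
  obtain ⟨a, ha⟩ : S.Nonempty := Finset.card_pos.1 (by omega)
  obtain ⟨⟨x, y⟩, hxy, hmax⟩ := Finset.exists_max_image (S ×ˢ S) (fun q => hex (q.2 - q.1))
    ⟨(a, a), by simp [ha]⟩
  rw [Finset.mem_product] at hxy
  have hmax' : ∀ a ∈ S, ∀ b ∈ S, hex (b - a) ≤ hex (y - x) := fun a ha b hb =>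
    hmax (a, b) (by simp [ha, hb])
  by_cases h1 : hex (y - x) ≤ 1
  · left
    exact fun a ha b hb => (hmax' a ha b hb).trans h1
  right
  have hne : y - x ≠ 0 := by
    intro h0
    rw [h0] at h1
    simp [hex] at h1
  obtain ⟨k, p, d, hd1, hd2, hp, hpd, hh⟩ : ∃ (k : Fin 3) (p d : ℤ × ℤ), 1 ≤ d.1 ∧ 0 ≤ d.2 ∧
      rot n k p ∈ S ∧ rot n k (p + d) ∈ S ∧ hex (y - x) = hex d := by
    obtain ⟨k, d, hd1, hd2, e | e⟩ := exists_rot_eq hne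
    · obtain ⟨p, rfl⟩ := rot_surjective n k x
      refine ⟨k, p, d, hd1, hd2, hxy.1, ?_, by rw [e, hex_rot]⟩
      rw [rot_add, ← e]
      simpa using hxy.2
    · obtain ⟨p, rfl⟩ := rot_surjective n k y
      refine ⟨k, p, d, hd1, hd2, hxy.2, ?_, by rw [e, hex_neg, hex_rot]⟩
      rw [rot_add, ← neg_neg (rot 0 k d), ← e]
      simpa using hxy.1
  rw [hh, hex_of_nonneg (by omega) hd2] at h1
  rw [hh, hex_of_nonneg (by omega) hd2] at hmax'
  have hunit : ∀ z, rot n k z ∈ S → z ≠ p → z ≠ p + d → IsUnit (pdet d (z - p)) := by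
    intro z hz h2 h3
    have h4 : p ≠ p + d := by
      intro e
      have : d = 0 := by simpa using e.symm
      rw [this] at hd1
      simp at hd1
    have := hS _ hp _ hpd _ hz ((rot_injective n k).ne h4) ((rot_injective n k).ne h2.symm)
      ((rot_injective n k).ne h3.symm)
    rwa [rot_sub, rot_sub, pdet_rot, add_sub_cancel_left] at this
  -- A third point makes `d` primitive. Then `d.2 = 0` would force `d = (1, 0)`, of norm 1, so `d`
  -- lies in the open quadrant and has parents.
  obtain ⟨z, hz, hz2⟩ := Finset.exists_mem_notMem_of_card_lt_card
    (s := {rot n k p, rot n k (p + d)}) (t := S) (lt_of_le_of_lt Finset.card_le_two (by omega))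
  obtain ⟨z, rfl⟩ := rot_surjective n k z
  simp only [Finset.mem_insert, Finset.mem_singleton, not_or, (rot_injective n k).eq_iff] at hz2
  have hcop : IsCoprime d.1 d.2 := isCoprime_iff_exists_pdet.2 ⟨_, hunit z hz hz2.1 hz2.2⟩
  have hd2' : 1 ≤ d.2 := by
    by_contra! hlt
    have : d.2 = 0 := by omega
    rw [this, isCoprime_zero_right, Int.isUnit_iff] at hcop
    omega
  obtain ⟨u, v, hu1, hu2, hv1, hv2, hdet, rfl⟩ := exists_parents hd1 hd2' hcop
  refine ⟨(k, p, u, v), ⟨?_, ⟨hu1, hu2⟩, ⟨hv1, hv2⟩, hdet⟩, hp, by rwa [add_assoc], ?_⟩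
  · have h5 := rot_mem_triPoints.1 (hT _ hp)
    have h6 := rot_mem_triPoints.1 (hT _ hpd)
    simp only [triPoints, Set.mem_ofPred_eq, Prod.fst_add, Prod.snd_add] at h5 h6 ⊢
    omega
  · intro z hz
    obtain ⟨z, rfl⟩ := rot_surjective n k z
    simp only [quad, Finset.mem_insert, Finset.mem_singleton, (rot_injective n k).eq_iff]
    by_cases e1 : z = p
    · exact .inl e1
    by_cases e2 : z = p + (u + v)
    · right; right; right; rw [e2, add_assoc]
    -- Maximality seen from `p` bounds the coordinate sum of `z - p` above by that of `d`; seen from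
    -- `p + d` it bounds it below by 0.
    have m1 := hmax' _ hp _ hz
    have m2 := hmax' _ hpd _ hz
    rw [rot_sub, hex_rot] at m1 m2
    simp only [hex, Prod.fst_sub, Prod.snd_sub, Prod.fst_add, Prod.snd_add] at m1 m2
    rcases eq_parent_of_isUnit hu1 hu2 hv1 hv2 hdet (hunit z hz e1 e2)
      (by simp only [Prod.fst_sub, Prod.snd_sub]; omega)
      (by simp only [Prod.fst_sub, Prod.snd_sub]; omega) with e | e
    · right; left; rw [← e]; simp
    · right; right; left; rw [← e]; simp

lemma card_quad {n : ℕ} {x : Fin 3 × (ℤ × ℤ) × (ℤ × ℤ) × (ℤ × ℤ)} : (quad n x).card ≤ 4 :=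
  Finset.card_le_four

lemma card_parallelogram {p u v : ℤ × ℤ} (h : pdet u v = 1) :
    ({p, p + u, p + v, p + u + v} : Finset (ℤ × ℤ)).card = 4 := by
  have hu : u ≠ 0 := by rintro rfl; simp [pdet] at h
  have hv : v ≠ 0 := by rintro rfl; simp [pdet] at h
  have huv : u ≠ v := by rintro rfl; simp [pdet, mul_comm] at h
  have huv' : u + v ≠ 0 := by
    intro e
    rw [eq_neg_of_add_eq_zero_left e] at h
    simp [pdet, mul_comm] at h
  rw [Finset.card_eq_succ]
  refine ⟨p, {p + u, p + v, p + u + v}, ?_, rfl, ?_⟩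
  · simp [hu, hv, huv', add_assoc]
  · rw [Finset.card_eq_three]
    refine ⟨_, _, _, ?_, ?_, ?_, rfl⟩
    · simpa using huv
    · simpa using hv
    · rw [add_right_comm]; simpa using hu

lemma card_triangle {p u v : ℤ × ℤ} (h : pdet u v = 1) :
    ({p, p + u, p + v} : Finset (ℤ × ℤ)).card = 3 := by
  have hu : u ≠ 0 := by rintro rfl; simp [pdet] at h
  have hv : v ≠ 0 := by rintro rfl; simp [pdet] at h
  have huv : u ≠ v := by rintro rfl; simp [pdet, mul_comm] at h
  rw [Finset.card_eq_three]
  refine ⟨_, _, _, ?_, ?_, ?_, rfl⟩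
  · simpa using hu
  · simpa using hv
  · simpa using huv

lemma quad_mem_triPoints {n : ℕ} {x : Fin 3 × (ℤ × ℤ) × (ℤ × ℤ) × (ℤ × ℤ)} (hx : x.2 ∈ bases n)
    {q : ℤ × ℤ} (hq : q ∈ quad n x) : q ∈ triPoints n := by
  obtain ⟨k, p, u, v⟩ := x
  obtain ⟨h1, hu, hv, -⟩ := hx
  obtain ⟨q, rfl⟩ := rot_surjective n k q
  rw [rot_mem_triPoints]
  simp only [quad, Finset.mem_insert, Finset.mem_singleton, (rot_injective n k).eq_iff] at *
  rcases hq with rfl | rfl | rfl | rfl <;>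
    simp only [triPoints, Set.mem_ofPred_eq, Prod.fst_add, Prod.snd_add] <;> omega

lemma bounds_of_hex_le_one {d : ℤ × ℤ} (h : hex d ≤ 1) :
    (-1 ≤ d.1 ∧ d.1 ≤ 1) ∧ (-1 ≤ d.2 ∧ d.2 ≤ 1) ∧ -1 ≤ d.1 + d.2 ∧ d.1 + d.2 ≤ 1 := by
  simp only [hex] at h; omega

lemma parallelograms_eq_image (n : ℕ) :
    parallelograms n = quad n '' (Set.univ ×ˢ bases n) := by
  ext S
  constructor
  · rintro ⟨hT, p, u, v, h, rfl⟩
    have hc := card_parallelogram (p := p) h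
    rcases (unimodular_parallelogram (p := p) h).subset_quad (by omega) hT with hhex | hex
    · exfalso
      -- For a unimodular pair, `u`, `v`, `u + v` and `v - u` cannot all lie in the small hexagon,
      -- so a parallelogram always has a long diagonal.
      have b1 := bounds_of_hex_le_one (hhex p (by simp) (p + u) (by simp))
      have b2 := bounds_of_hex_le_one (hhex p (by simp) (p + v) (by simp))
      have b3 := bounds_of_hex_le_one (hhex p (by simp) (p + u + v) (by simp))
      have b4 := bounds_of_hex_le_one (hhex (p + u) (by simp) (p + v) (by simp))
      obtain ⟨u1, u2⟩ := u
      obtain ⟨v1, v2⟩ := v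
      simp only [Prod.fst_sub, Prod.snd_sub, Prod.fst_add, Prod.snd_add, pdet] at b1 b2 b3 b4 h
      obtain ⟨hl, hr⟩ : -1 ≤ u1 ∧ u1 ≤ 1 := by omega
      obtain ⟨hl', hr'⟩ : -1 ≤ u2 ∧ u2 ≤ 1 := by omega
      interval_cases u1 <;> interval_cases u2 <;> omega
    · obtain ⟨x, hx, -, -, hsub⟩ := hex
      exact ⟨x, ⟨trivial, hx⟩, (Finset.eq_of_subset_of_card_le hsub (card_quad.trans hc.ge)).symm⟩
  · rintro ⟨⟨k, p, u, v⟩, ⟨-, hx⟩, rfl⟩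
    refine ⟨fun q hq => quad_mem_triPoints hx hq, rot n k p, rot 0 k u, rot 0 k v, ?_, ?_⟩
    · rw [pdet_rot]; exact hx.2.2.2
    · simp only [quad, rot_add]

/-! ### Small triangles and the classification of triangles -/

/-- The translates of the standard triangle. -/
def upTriangle (p : ℤ × ℤ) : Finset (ℤ × ℤ) := {p, p + (1, 0), p + (0, 1)}

/-- The translates of the reflected standard triangle. -/
def downTriangle (p : ℤ × ℤ) : Finset (ℤ × ℤ) := {p + (1, 1), p + (0, 1), p + (1, 0)}

/-- Base points at which a shape of size `m` fits into the triangle of size `n`. -/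
def corners (n m : ℕ) : Set (ℤ × ℤ) := {p | 0 ≤ p.1 ∧ 0 ≤ p.2 ∧ p.1 + p.2 + m ≤ n}

/-- `u`, `v` must be consecutive among the six nonzero vectors of the small hexagon. The six
consecutive pairs alternately give up and down triangles. -/
lemma eq_upTriangle_or_eq_downTriangle {p u v : ℤ × ℤ} (h : pdet u v = 1) (hu : hex u ≤ 1)
    (hv : hex v ≤ 1) (huv : hex (v - u) ≤ 1) :
    ∃ q, ({p, p + u, p + v} : Finset (ℤ × ℤ)) = upTriangle q ∨
      ({p, p + u, p + v} : Finset (ℤ × ℤ)) = downTriangle q := by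
  have b1 := bounds_of_hex_le_one hu
  have b2 := bounds_of_hex_le_one hv
  have b3 := bounds_of_hex_le_one huv
  obtain ⟨p1, p2⟩ := p
  obtain ⟨u1, u2⟩ := u
  obtain ⟨v1, v2⟩ := v
  simp only [pdet, Prod.fst_sub, Prod.snd_sub] at h b1 b2 b3
  have : (u1 = 1 ∧ u2 = 0 ∧ v1 = 0 ∧ v2 = 1) ∨ (u1 = 0 ∧ u2 = 1 ∧ v1 = -1 ∧ v2 = 1) ∨
      (u1 = -1 ∧ u2 = 1 ∧ v1 = -1 ∧ v2 = 0) ∨ (u1 = -1 ∧ u2 = 0 ∧ v1 = 0 ∧ v2 = -1) ∨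
      (u1 = 0 ∧ u2 = -1 ∧ v1 = 1 ∧ v2 = -1) ∨ (u1 = 1 ∧ u2 = -1 ∧ v1 = 1 ∧ v2 = 0) := by
    obtain ⟨hl, hr⟩ : -1 ≤ u1 ∧ u1 ≤ 1 := by omega
    obtain ⟨hl', hr'⟩ : -1 ≤ u2 ∧ u2 ≤ 1 := by omega
    interval_cases u1 <;> interval_cases u2 <;> omega
  rcases this with ⟨rfl, rfl, rfl, rfl⟩ | ⟨rfl, rfl, rfl, rfl⟩ | ⟨rfl, rfl, rfl, rfl⟩ |
    ⟨rfl, rfl, rfl, rfl⟩ | ⟨rfl, rfl, rfl, rfl⟩ | ⟨rfl, rfl, rfl, rfl⟩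
  · exact ⟨(p1, p2), .inl rfl⟩
  · exact ⟨(p1 - 1, p2), .inr (by ext ⟨a, b⟩; simp [downTriangle]; omega)⟩
  · exact ⟨(p1 - 1, p2), .inl (by ext ⟨a, b⟩; simp [upTriangle]; omega)⟩
  · exact ⟨(p1 - 1, p2 - 1), .inr (by ext ⟨a, b⟩; simp [downTriangle]; omega)⟩
  · exact ⟨(p1, p2 - 1), .inl (by ext ⟨a, b⟩; simp [upTriangle]; omega)⟩
  · exact ⟨(p1, p2 - 1), .inr (by ext ⟨a, b⟩; simp [downTriangle]; omega)⟩

lemma triangles_eq_union (n : ℕ) :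
    triangles n = halfQuad n '' ((Set.univ ×ˢ bases n) ×ˢ Set.univ) ∪
      (upTriangle '' corners n 1 ∪ downTriangle '' corners n 2) := by
  ext S
  constructor
  · rintro ⟨hT, p, u, v, h, rfl⟩
    have hc := card_triangle (p := p) h
    have hU : Unimodular {p, p + u, p + v} :=
      (unimodular_parallelogram h).subset (by intro z; simp; tauto)
    rcases hU.subset_quad (by omega) hT with hhex | ⟨x, hx, hd, hd', hsub⟩
    · right
      obtain ⟨q, e | e⟩ := eq_upTriangle_or_eq_downTriangle (p := p) h
        (by simpa using hhex p (by simp) (p + u) (by simp))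
        (by simpa using hhex p (by simp) (p + v) (by simp))
        (by simpa using hhex (p + u) (by simp) (p + v) (by simp)) <;> rw [e] at hT ⊢
      · left
        refine ⟨q, ?_, rfl⟩
        have h1 := hT q (by simp [upTriangle])
        have h2 := hT (q + (1, 0)) (by simp [upTriangle])
        simp only [triPoints, corners, Set.mem_ofPred_eq, Prod.fst_add, Prod.snd_add] at *
        omega
      · right
        refine ⟨q, ?_, rfl⟩
        have h1 := hT (q + (0, 1)) (by simp [downTriangle])
        have h2 := hT (q + (1, 0)) (by simp [downTriangle])
        have h3 := hT (q + (1, 1)) (by simp [downTriangle])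
        simp only [triPoints, corners, Set.mem_ofPred_eq, Prod.fst_add, Prod.snd_add] at *
        omega
    · left
      -- The vertex off the long diagonal is one of the two other corners of the parallelogram and
      -- selects the half.
      obtain ⟨z, hz, hz2⟩ := Finset.exists_mem_notMem_of_card_lt_card
        (s := {rot n x.1 x.2.1, rot n x.1 (x.2.1 + x.2.2.1 + x.2.2.2)}) (t := {p, p + u, p + v})
        (lt_of_le_of_lt Finset.card_le_two (by omega))
      simp only [Finset.mem_insert, Finset.mem_singleton, not_or] at hz2
      have key : ∀ b : Bool, halfQuad n (x, b) ⊆ {p, p + u, p + v} →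
          halfQuad n (x, b) = {p, p + u, p + v} := by
        intro b hb
        refine Finset.eq_of_subset_of_card_le hb ?_
        rw [hc]
        have hdet := hx.2.2.2
        have hinj := Finset.card_image_of_injective
          ({x.2.1, x.2.1 + (x.2.2.1 + x.2.2.2), x.2.1 + bif b then x.2.2.1 else x.2.2.2} :
            Finset (ℤ × ℤ)) (rot_injective n x.1)
        have hcard : ({x.2.1, x.2.1 + (x.2.2.1 + x.2.2.2),
            x.2.1 + bif b then x.2.2.1 else x.2.2.2} : Finset (ℤ × ℤ)).card = 3 := by
          cases b
          · exact card_triangle (by simp only [pdet, Prod.fst_add, Prod.snd_add, cond_false] at *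
                                    linear_combination hdet)
          · rw [Finset.pair_comm]
            exact card_triangle (by simp only [pdet, Prod.fst_add, Prod.snd_add, cond_true] at *
                                    linear_combination hdet)
        rw [hcard] at hinj
        refine hinj.ge.trans (le_of_eq ?_)
        simp [halfQuad, add_assoc]
      have hz3 := hsub hz
      simp only [quad, Finset.mem_insert, Finset.mem_singleton] at hz3
      rcases hz3 with e | rfl | rfl | e
      · exact absurd e hz2.1
      · refine ⟨(x, true), ⟨⟨trivial, hx⟩, trivial⟩, key true ?_⟩
        intro q hq
        simp only [halfQuad, Finset.mem_insert, Finset.mem_singleton] at hq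
        rcases hq with rfl | rfl | rfl
        exacts [hd, hd', hz]
      · refine ⟨(x, false), ⟨⟨trivial, hx⟩, trivial⟩, key false ?_⟩
        intro q hq
        simp only [halfQuad, Finset.mem_insert, Finset.mem_singleton] at hq
        rcases hq with rfl | rfl | rfl
        exacts [hd, hd', hz]
      · exact absurd e hz2.2
  · rintro (⟨⟨⟨k, p, u, v⟩, b⟩, ⟨⟨-, hx⟩, -⟩, rfl⟩ | ⟨p, hp, rfl⟩ | ⟨p, hp, rfl⟩)
    · refine ⟨fun q hq => quad_mem_triPoints hx (halfQuad_subset _ _ _ hq), rot n k p, ?_⟩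
      have hdet : pdet u v = 1 := hx.2.2.2
      cases b
      · refine ⟨rot 0 k (u + v), rot 0 k v, ?_, by simp only [halfQuad, ← rot_add, add_assoc]; rfl⟩
        rw [pdet_rot]
        simp only [pdet, Prod.fst_add, Prod.snd_add] at *
        linear_combination hdet
      · refine ⟨rot 0 k u, rot 0 k (u + v), ?_, ?_⟩
        · rw [pdet_rot]
          simp only [pdet, Prod.fst_add, Prod.snd_add] at *
          linear_combination hdet
        · simp only [halfQuad, ← rot_add, add_assoc, cond_true]
          rw [Finset.pair_comm]
    · refine ⟨?_, p, (1, 0), (0, 1), by simp [pdet], rfl⟩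
      simp only [upTriangle, Finset.mem_insert, Finset.mem_singleton]
      rintro q (rfl | rfl | rfl) <;>
        simp only [triPoints, corners, Set.mem_ofPred_eq, Prod.fst_add, Prod.snd_add] at * <;> omega
    · refine ⟨?_, p + (1, 1), (-1, 0), (0, -1), by simp [pdet], ?_⟩
      · simp only [downTriangle, Finset.mem_insert, Finset.mem_singleton]
        rintro q (rfl | rfl | rfl) <;>
          simp only [triPoints, corners, Set.mem_ofPred_eq, Prod.fst_add, Prod.snd_add] at * <;>
          omega
      · simp [downTriangle, add_assoc]

lemma upTriangle_injective : Function.Injective upTriangle := by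
  intro p q h
  have h1 : p ∈ upTriangle q := h ▸ by simp [upTriangle]
  have h2 : q ∈ upTriangle p := h ▸ by simp [upTriangle]
  simp only [upTriangle, Finset.mem_insert, Finset.mem_singleton, Prod.ext_iff, Prod.fst_add,
    Prod.snd_add] at *
  omega

lemma downTriangle_injective : Function.Injective downTriangle := by
  intro p q h
  have h1 : p + (1, 1) ∈ downTriangle q := h ▸ by simp [downTriangle]
  have h2 : q + (1, 1) ∈ downTriangle p := h ▸ by simp [downTriangle]
  simp only [downTriangle, Finset.mem_insert, Finset.mem_singleton, Prod.ext_iff, Prod.fst_add,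
    Prod.snd_add] at *
  omega

lemma upTriangle_ne_downTriangle (p q : ℤ × ℤ) : upTriangle p ≠ downTriangle q := by
  intro h
  have h1 : q + (1, 1) ∈ upTriangle p := h ▸ by simp [downTriangle]
  have h2 : q + (1, 0) ∈ upTriangle p := h ▸ by simp [downTriangle]
  have h3 : q + (0, 1) ∈ upTriangle p := h ▸ by simp [downTriangle]
  simp only [upTriangle, Finset.mem_insert, Finset.mem_singleton, Prod.ext_iff, Prod.fst_add,
    Prod.snd_add] at *
  omega

lemma halfQuad_ne_of_hex_le_one {n : ℕ} {x : Fin 3 × (ℤ × ℤ) × (ℤ × ℤ) × (ℤ × ℤ)}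
    (hx : x.2 ∈ bases n) (b : Bool) {S : Finset (ℤ × ℤ)}
    (hS : ∀ p ∈ S, ∀ q ∈ S, hex (q - p) ≤ 1) : halfQuad n (x, b) ≠ S := by
  rintro rfl
  obtain ⟨k, p, u, v⟩ := x
  obtain ⟨-, hu, hv, h⟩ := hx
  obtain ⟨a1, a2⟩ := pos_of_pdet_eq_one hu.1 hu.2 hv.1 hv.2 h
  have := hS (rot n k p) (by simp [halfQuad]) (rot n k (p + u + v)) (by simp [halfQuad])
  rw [rot_sub, hex_rot, add_assoc, add_sub_cancel_left,
    hex_of_nonneg (by simp at *; omega) (by simp at *; omega)] at this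
  simp only [Prod.fst_add, Prod.snd_add] at *
  omega

lemma hex_upTriangle (p : ℤ × ℤ) :
    ∀ x ∈ upTriangle p, ∀ y ∈ upTriangle p, hex (y - x) ≤ 1 := by
  intro x hx y hy
  simp only [upTriangle, Finset.mem_insert, Finset.mem_singleton] at hx hy
  rcases hx with rfl | rfl | rfl <;> rcases hy with rfl | rfl | rfl <;> simp [hex]

lemma hex_downTriangle (p : ℤ × ℤ) :
    ∀ x ∈ downTriangle p, ∀ y ∈ downTriangle p, hex (y - x) ≤ 1 := by
  intro x hx y hy
  simp only [downTriangle, Finset.mem_insert, Finset.mem_singleton] at hx hy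
  rcases hx with rfl | rfl | rfl <;> rcases hy with rfl | rfl | rfl <;> simp [hex]

/-! ### Counting base points and primitive vectors -/

/-- The corners as a finset. -/
def cornersFinset (m : ℕ) : Finset (ℤ × ℤ) :=
  ((Finset.range m).sigma fun i => Finset.range (i + 1)).image
    fun x => ((x.2 : ℤ), (x.1 : ℤ) - x.2)

lemma mem_cornersFinset {m : ℕ} {p : ℤ × ℤ} :
    p ∈ cornersFinset m ↔ 0 ≤ p.1 ∧ 0 ≤ p.2 ∧ p.1 + p.2 < m := by
  simp only [cornersFinset, Finset.mem_image, Finset.mem_sigma, Finset.mem_range]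
  constructor
  · rintro ⟨⟨i, j⟩, ⟨h1, h2⟩, rfl⟩
    simp only at *
    omega
  · rintro ⟨h1, h2, h3⟩
    refine ⟨⟨(p.1 + p.2).toNat, p.1.toNat⟩, ⟨?_, ?_⟩, ?_⟩
    · simp only; omega
    · simp only; omega
    · ext <;> simp only <;> omega

lemma card_cornersFinset (m : ℕ) : (cornersFinset m).card = (m + 1).choose 2 := by
  rw [cornersFinset, Finset.card_image_of_injective, Finset.card_sigma]
  · simp only [Finset.card_range]
    induction m with
    | zero => rfl
    | succ k ih =>
      rw [Finset.sum_range_succ, ih, Nat.choose_succ_succ' (k + 1) 1, Nat.choose_one_right, add_comm]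
  · rintro ⟨i, j⟩ ⟨i', j'⟩ h
    simp only [Prod.mk.injEq] at h
    obtain rfl : j = j' := by omega
    obtain rfl : i = i' := by omega
    rfl

/-- For `m > n` the truncated `n + 1 - m` is 0, and both sides are empty. -/
lemma corners_eq (n m : ℕ) : corners n m = cornersFinset (n + 1 - m) := by
  ext p
  simp only [corners, Set.mem_ofPred_eq, Finset.mem_coe, mem_cornersFinset]
  omega

lemma ncard_corners (n m : ℕ) (h : m ≤ n + 1) : (corners n m).ncard = (n + 2 - m).choose 2 := by
  rw [corners_eq, Set.ncard_coe_finset, card_cornersFinset]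
  congr 1
  omega

lemma corners_zero (n : ℕ) : corners n 0 = triPoints n := by
  ext p; simp [corners, triPoints]

lemma finite_corners (n m : ℕ) : (corners n m).Finite := by
  rw [corners_eq]; exact Finset.finite_toSet _

/-- Vectors of the half-open quadrant with hexagonal norm `l` that are primitive. -/
noncomputable def primitives (l : ℕ) : Finset (ℤ × ℤ) :=
  ((Finset.Icc (1 : ℤ) l).filter fun a => Int.gcd a l = 1).image fun a => (a, (l : ℤ) - a)

/-- Uses that `a` is coprime to `l - a` exactly when it is coprime to `l`. -/
lemma mem_primitives {l : ℕ} {d : ℤ × ℤ} :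
    d ∈ primitives l ↔ 1 ≤ d.1 ∧ 0 ≤ d.2 ∧ IsCoprime d.1 d.2 ∧ d.1 + d.2 = l := by
  simp only [primitives, Finset.mem_image, Finset.mem_filter, Finset.mem_Icc,
    ← Int.isCoprime_iff_gcd_eq_one]
  constructor
  · rintro ⟨a, ⟨⟨h1, h2⟩, h3⟩, rfl⟩
    refine ⟨h1, by simp only; omega, ?_, by simp⟩
    have := h3.add_mul_left_right (-1)
    simpa [sub_eq_add_neg] using this
  · rintro ⟨h1, h2, h3, h4⟩
    refine ⟨d.1, ⟨⟨h1, by omega⟩, ?_⟩, by ext <;> simp; omega⟩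
    rw [← h4]
    have := h3.add_mul_left_right 1
    simpa [add_comm] using this

lemma card_primitives (l : ℕ) : (primitives l).card = jordanTotient 1 l := by
  rw [primitives, Finset.card_image_of_injective _ fun a b h => (Prod.mk.inj h).1, jordanTotient]
  refine Finset.card_bij (fun a _ => fun _ => a) ?_ ?_ ?_
  · intro a ha
    rw [Finset.mem_filter, Finset.mem_Icc] at ha
    simpa [Int.gcd, ← Int.abs_eq_normalize, Int.natAbs_abs] using ha
  · intro a _ b _ h
    exact congrFun h 0
  · intro f hf
    refine ⟨f 0, ?_, ?_⟩
    · rw [Finset.mem_filter, Finset.mem_Icc]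
      simpa [Int.gcd, ← Int.abs_eq_normalize, Int.natAbs_abs] using hf
    · funext i
      rw [Subsingleton.elim i 0]

/-- Sorted by `l = d.1 + d.2`: the base points of such a vector fill the triangle of size `n - l`;
the `+ 1` is there because `cornersFinset` uses a strict bound. -/
lemma directed_eq (n : ℕ) : directed n =
    (((Finset.range (n + 1)).sigma fun l => cornersFinset (n - l + 1) ×ˢ primitives l).image
      fun x => x.2 : Finset ((ℤ × ℤ) × (ℤ × ℤ))) := by
  ext ⟨p, d⟩
  simp only [directed, Set.mem_ofPred_eq, Finset.coe_image, Set.mem_image, Finset.mem_coe,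
    Finset.mem_sigma, Finset.mem_range, Finset.mem_product, mem_cornersFinset, mem_primitives]
  constructor
  · rintro ⟨⟨h1, h2, h3⟩, h4, h5, h6⟩
    refine ⟨⟨(d.1 + d.2).toNat, (p, d)⟩, ⟨?_, ⟨h1, h2, ?_⟩, h4, h5, h6, ?_⟩, rfl⟩ <;>
      simp only <;> omega
  · rintro ⟨⟨l, p, d⟩, ⟨h1, ⟨h2, h3, h4⟩, h5, h6, h7, h8⟩, e⟩
    obtain ⟨rfl, rfl⟩ := Prod.mk.inj e
    simp only at *
    exact ⟨⟨h2, h3, by omega⟩, h5, h6, h7⟩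

lemma ncard_directed (n : ℕ) : (directed n).ncard =
    ∑ l ∈ Finset.range (n + 1), (n - l + 2).choose 2 * jordanTotient 1 l := by
  rw [directed_eq, Set.ncard_coe_finset, Finset.card_image_of_injOn, Finset.card_sigma]
  · simp only [Finset.card_product, card_cornersFinset, card_primitives]
  · rintro ⟨l, p, d⟩ h ⟨l', p', d'⟩ h' e
    simp only [Finset.coe_sigma, Set.mem_sigma_iff, Finset.mem_coe, Finset.mem_product,
      mem_primitives] at h h'
    obtain ⟨rfl, rfl⟩ := Prod.mk.inj e
    obtain rfl : l = l' := by
      have := h.2.2.2.2.2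
      have := h'.2.2.2.2.2
      omega
    rfl

lemma finite_directed (n : ℕ) : (directed n).Finite := by
  rw [directed_eq]; exact Finset.finite_toSet _

/-- Directions in the open quadrant correspond to their parents. On the boundary only `(1, 0)` is
primitive, with C(n+1, 2) base points. -/
lemma ncard_directed_eq_add (n : ℕ) :
    (directed n).ncard = (bases n).ncard + (n + 1).choose 2 := by
  have h1 : directed n = {x ∈ directed n | 1 ≤ x.2.2} ∪ (fun p => (p, (1, 0))) '' corners n 1 := by
    ext ⟨p, d⟩
    simp only [Set.mem_union, Set.mem_ofPred_eq, Set.mem_image, Prod.mk.injEq]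
    constructor
    · intro h
      by_cases h2 : 1 ≤ d.2
      · exact .inl ⟨h, h2⟩
      · right
        obtain ⟨⟨a1, a2, a3⟩, a4, a5, a6⟩ := h
        simp only at *
        have hd2 : d.2 = 0 := by omega
        rw [hd2, isCoprime_zero_right, Int.isUnit_iff] at a6
        have hd1 : d.1 = 1 := by omega
        exact ⟨p, ⟨a1, a2, by push_cast; omega⟩, rfl, Prod.ext hd1.symm hd2.symm⟩
    · rintro (h | ⟨q, ⟨a1, a2, a3⟩, rfl, rfl⟩)
      · exact h.1
      · refine ⟨⟨a1, a2, by push_cast at a3; simp only; omega⟩, le_rfl, le_rfl, isCoprime_one_left⟩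
  have hfin : {x ∈ directed n | 1 ≤ x.2.2}.Finite := (finite_directed n).subset fun x hx => hx.1
  rw [h1, Set.ncard_union_eq ?_ hfin ((finite_corners n 1).image _), ← ncard_bases,
    Set.ncard_image_of_injective, ncard_corners n 1 (by omega)]
  · rfl
  · intro p q h
    exact (Prod.mk.inj h).1
  · rw [Set.disjoint_left]
    rintro ⟨p, d⟩ ⟨-, h⟩ ⟨q, -, e⟩
    obtain ⟨rfl, rfl⟩ := Prod.mk.inj e
    simp at h

/-! ### Final counts -/

lemma finite_bases (n : ℕ) : (bases n).Finite := by
  refine Set.Finite.of_finite_image ?_ (injOn_bases n)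
  rw [image_bases]
  exact (finite_directed n).subset fun x hx => hx.1

lemma ncard_parallelograms (n : ℕ) : (parallelograms n).ncard = 3 * (bases n).ncard := by
  rw [parallelograms_eq_image, (quad_injOn n).ncard_image, Set.ncard_prod]
  simp

/-- The factor 6 is three rotations times two halves; the remaining terms count the up and down
triangles. -/
lemma ncard_triangles (n : ℕ) : (triangles n).ncard =
    6 * (bases n).ncard + ((n + 1).choose 2 + n.choose 2) := by
  have hdisj : Disjoint (upTriangle '' corners n 1) (downTriangle '' corners n 2) := by
    rw [Set.disjoint_left]
    rintro _ ⟨p, -, rfl⟩ ⟨q, -, e⟩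
    exact upTriangle_ne_downTriangle p q e.symm
  have hdisj' : Disjoint (halfQuad n '' ((Set.univ ×ˢ bases n) ×ˢ Set.univ))
      (upTriangle '' corners n 1 ∪ downTriangle '' corners n 2) := by
    rw [Set.disjoint_left]
    rintro _ ⟨⟨x, b⟩, ⟨⟨-, hx⟩, -⟩, rfl⟩ (⟨p, -, e⟩ | ⟨p, -, e⟩)
    · exact halfQuad_ne_of_hex_le_one hx b (hex_upTriangle p) e.symm
    · exact halfQuad_ne_of_hex_le_one hx b (hex_downTriangle p) e.symm
  have hup := (finite_corners n 1).image upTriangle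
  have hdown := (finite_corners n 2).image downTriangle
  rw [triangles_eq_union, Set.ncard_union_eq hdisj'
      (((Set.finite_univ.prod (finite_bases n)).prod Set.finite_univ).image _) (hup.union hdown),
    Set.ncard_union_eq hdisj hup hdown, (halfQuad_injOn n).ncard_image, Set.ncard_prod,
    Set.ncard_prod, Set.ncard_image_of_injective _ upTriangle_injective,
    Set.ncard_image_of_injective _ downTriangle_injective, ncard_corners n 1 (by omega)]
  have h2 : (corners n 2).ncard = n.choose 2 := by
    -- `ncard_corners` needs `2 ≤ n + 1`, which fails for `n = 0`.
    rcases Nat.eq_zero_or_pos n with rfl | hn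
    · rw [Nat.choose_zero_succ]
      convert Set.ncard_empty (ℤ × ℤ)
      ext p
      simp only [corners, Set.mem_ofPred_eq, Set.mem_empty_iff_false, iff_false]
      push_cast
      omega
    · rw [ncard_corners n 2 (by omega)]; rfl
  rw [h2]
  simp
  ring

end FreePolytopes

theorem corollary4 (P : Set (Fin 2 → ℝ)) (hP : FreePolytopes.IsUnimodularSimplex P) (n : ℕ) :
    (∀ i : ℕ, (FreePolytopes.freePolytopes i ((n : ℝ) • P)).Finite) ∧
    FreePolytopes.alpha 1 P n = (n + 2).choose 2 ∧
    FreePolytopes.alpha 2 P n =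
      3 * ∑ l ∈ Finset.range (n + 1), (n - l + 2).choose 2 * FreePolytopes.jordanTotient 1 l ∧
    (FreePolytopes.alpha 3 P n : ℚ) =
      6 * (∑ l ∈ Finset.range (n + 1),
        ((n - l + 2).choose 2 : ℚ) * (FreePolytopes.jordanTotient 1 l : ℚ))
        - 2 * (n : ℚ) ^ 2 - 3 * (n : ℚ) ∧
    (FreePolytopes.alpha 4 P n : ℚ) =
      3 * (∑ l ∈ Finset.range (n + 1),
        ((n - l + 2).choose 2 : ℚ) * (FreePolytopes.jordanTotient 1 l : ℚ))
        - 3 / 2 * ((n : ℚ) ^ 2 + (n : ℚ)) ∧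
    ∀ i : ℕ, 4 < i → FreePolytopes.alpha i P n = 0 := by
  open FreePolytopes in
  -- This relation eliminates the number of bases in favour of Σ_n in the last two formulas.
  have hsum : (∑ l ∈ Finset.range (n + 1), ((n - l + 2).choose 2 : ℚ) * (jordanTotient 1 l : ℚ)) =
      (bases n).ncard + (n + 1).choose 2 := by
    have := ncard_directed n
    rw [ncard_directed_eq_add] at this
    exact_mod_cast this.symm
  refine ⟨finite_freePolytopes hP, ?_, ?_, ?_, ?_, fun i hi => alpha_eq_zero hP hi⟩
  · rw [alpha_one_eq hP, ← corners_zero, ncard_corners n 0 (by omega), Nat.sub_zero]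
  · rw [alpha_two_eq hP, ncard_segments, ncard_directed]
  · rw [alpha_three_eq hP, ncard_triangles, hsum]
    push_cast [Nat.cast_choose_two]
    ring
  · rw [alpha_four_eq hP, ncard_parallelograms, hsum]
    push_cast [Nat.cast_choose_two]
    ring
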